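/- Words and sequences are binary. For a finite word $x$ write $|x|$ for its length, and for an infinite sequence $\mathbf x$ write $\mathbf x_{1:n}$ for its prefix of length $n$. For words put $\langle p,x\rangle:=1^{|p|}\,0\,p\,x$. A partial function $\varphi:\{0,1\}^*\times\{0,1\}^{\mathbb N}\rightharpoonup\{0,1\}^*$ is computable if $\varphi(x,\mathbf o)$ is computed by a single algorithm from the input $x$ with oracle access to $\mathbf o$. Fix a universal computable partial function $U$, i.e. one such that for every computable partial function $\varphi$ there is a word $p$ with $\varphi(x,\mathbf o)=U(\langle p,x\rangle,\mathbf o)$ for all $x,\mathbf o$ (one side being defined iff the other is). Put $K[x\mid\mathbf o]:=\min\{|q|:U(q,\mathbf o)=x\}$ and, for $\beta\in(1,2)$, $K[x\mid\beta]:=K[x\mid\mathbf y_\beta]$, where $\mathbf y_\beta$ is the greedy (lexicographically largest) binary expansion of $\beta-1$. For $\beta\in(1,2)$ let $\Omega_\beta$ be the set of $\mathbf x\in\{0,1\}^{\mathbb N}$ with $\sum_{i\ge1}\mathbf x_i\beta^{-i}\le1$, and let $n(\beta):=\lceil n\log_\beta2\rceil$. For words, $x\sim_\beta y$ means that $|x|=|y|=:n$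 and $\sum_{i=1}^n x_i\beta^{-i}=\sum_{i=1}^n y_i\beta^{-i}$; let $M_\beta(x)$ be the lexicographically largest word (with $0<1$) in the $\sim_\beta$-class of $x$. For $\mathbf x\in\Omega_\beta$ let $M_\beta\mathbf x$ denote the sequence of words $(M_\beta\mathbf x)_{1:n}:=M_\beta(\mathbf x_{1:n})$, $n\ge 0$ (these words need not be prefixes of one another), and define $$\underline\Delta_\beta(M_\beta\mathbf x):=\liminf_{n\to\infty}\frac{K[M_\beta(\mathbf x_{1:n(\beta)})\mid\beta]-K[\mathbf y_{1:n}\mid\beta]}{n},\qquad \overline\Delta_\beta(M_\beta\mathbf x):=\limsup_{n\to\infty}\frac{K[M_\beta(\mathbf x_{1:n(\beta)})\mid\beta]-K[\mathbf y_{1:n}\mid\beta]}{n},$$ where $\mathbf y$ is the greedy binary expansion of $s=\sum_{i\ge1}\mathbf x_i\beta^{-i}$. If $\beta$ is algebraic, let $P_\beta\in\mathbb Z[X]$ be its minimal polynomial over the integers: among the nonzero integer polynomials of least degree vanishing at $\beta$, the one with the least positive leading coefficient. Let $L_\beta>0$ be its leading coefficient and let $G_\beta$ (the Galois conjugates of $\beta$)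 be the set of complex roots of $P_\beta$ other than $\beta$. **Theorem.** Let $\beta\in(1,2)$ be algebraic. Then for every $\mathbf x\in\Omega_\beta$, $$0\le\underline\Delta_\beta(M_\beta\mathbf x)\le\overline\Delta_\beta(M_\beta\mathbf x)\le\log_\beta\Bigl(L_\beta\prod_{z\in G_\beta,\ |z|>1}|z|\Bigr).$$ -/

import Mathlib

open Polynomial

namespace BetaExp

/-! ### Computable functions `{0,1}* × {0,1}^ℕ → {0,1}*` and algorithmic complexity -/

/-- Partial recursive functions on `ℕ` with access to an infinite binary sequence `o`, uniformly in
`o`: the smallest class of functionals that contains zero, successor, the two projections of the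
pairing function and the query `n ↦ o n`, and is closed under pairing, composition, primitive
recursion and unbounded search. This is the uniform version of `Nat.RecursiveIn`. -/
inductive OracleRecursive : ((ℕ → Bool) → ℕ →. ℕ) → Prop
  | zero : OracleRecursive fun _ => pure 0
  | succ : OracleRecursive fun _ => Nat.succ
  | left : OracleRecursive fun _ n => Part.some (Nat.unpair n).1
  | right : OracleRecursive fun _ n => Part.some (Nat.unpair n).2
  | oracle : OracleRecursive fun o n => Part.some (o n).toNat
  | pair {f g : (ℕ → Bool) → ℕ →. ℕ} (hf : OracleRecursive f) (hg : OracleRecursive g) :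
      OracleRecursive fun o n => Nat.pair <$> f o n <*> g o n
  | comp {f g : (ℕ → Bool) → ℕ →. ℕ} (hf : OracleRecursive f) (hg : OracleRecursive g) :
      OracleRecursive fun o n => g o n >>= f o
  | prec {f g : (ℕ → Bool) → ℕ →. ℕ} (hf : OracleRecursive f) (hg : OracleRecursive g) :
      OracleRecursive fun o p =>
        let (a, n) := Nat.unpair p
        n.rec (f o a) fun y IH => do
          let i ← IH
          g o (Nat.pair a (Nat.pair y i))
  | rfind {f : (ℕ → Bool) → ℕ →. ℕ} (hf : OracleRecursive f) :
      OracleRecursive fun o a => Nat.rfind fun n => (fun m => m = 0) <$> f o (Nat.pair a n)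

/-- A (partial) function of a finite word, equipped with an infinite binary sequence, is computable
if it is so on the codes of the words. -/
def IsComputable (φ : (ℕ → Bool) → List Bool →. List Bool) : Prop :=
  OracleRecursive fun o n =>
    Part.bind (Encodable.decode (α := List Bool) n) fun x => (φ o x).map Encodable.encode

/-- The pairing `⟨p, x⟩ = 1^{|p|} 0 p x` of two words. -/
def pairWords (p x : List Bool) : List Bool :=
  List.replicate p.length true ++ false :: (p ++ x)

/-- Universal computable functions `U`: every computable `φ` has a program `p` such that
`φ(x, o) = U(⟨p, x⟩, o)` for all `x` and `o` (both sides being undefined together). -/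
def IsUniversal (U : (ℕ → Bool) → List Bool →. List Bool) : Prop :=
  IsComputable U ∧
    ∀ φ : (ℕ → Bool) → List Bool →. List Bool, IsComputable φ →
      ∃ p : List Bool, ∀ (o : ℕ → Bool) (x : List Bool), φ o x = U o (pairWords p x)

/-- Algorithmic complexity `K_U[x | o]`: the least length of a word that `U`, equipped with `o`,
sends to `x`. -/
noncomputable def complexity (U : (ℕ → Bool) → List Bool →. List Bool) (x : List Bool)
    (o : ℕ → Bool) : ℕ :=
  sInf {k | ∃ q : List Bool, q.length = k ∧ x ∈ U o q}

/-! ### Binary sequences and expansions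

The digit with index `i` of the mathematics is the entry with index `i - 1` here. -/

/-- A bit as a real number. -/
def bit (b : Bool) : ℝ := if b then 1 else 0

/-- The prefix of length `n` of an infinite sequence. -/
def initWord (x : ℕ → Bool) (n : ℕ) : List Bool := List.ofFn fun i : Fin n => x i

/-- `∑_{i=1}^{|w|} w_i β^{-i}` for a finite word `w`. -/
noncomputable def wordValue (β : ℝ) (w : List Bool) : ℝ :=
  ∑ i : Fin w.length, bit (w.get i) * (β ^ (i.val + 1))⁻¹

/-- `∑_{i=1}^∞ x_i β^{-i}` for an infinite sequence `x` (a convergent series if `β > 1`). -/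
noncomputable def seqValue (β : ℝ) (x : ℕ → Bool) : ℝ :=
  ∑' i : ℕ, bit (x i) * (β ^ (i + 1))⁻¹

/-- `Ω_β`: the sequences that are `β`-expansions of a number in `[0, 1]`. -/
def Omega (β : ℝ) : Set (ℕ → Bool) := {x | seqValue β x ≤ 1}

/-- The remainder after `n` steps of the greedy binary algorithm started at `s`. -/
noncomputable def greedyRem (s : ℝ) : ℕ → ℝ
  | 0 => s
  | n + 1 => 2 * greedyRem s n - (if greedyRem s n < 1 / 2 then 0 else 1)

/-- The greedy binary expansion of `s ∈ [0, 1]`, digit by digit. -/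
noncomputable def greedyBinary (s : ℝ) (n : ℕ) : Bool := decide (1 / 2 ≤ greedyRem s n)

theorem greedyRem_succ (s : ℝ) (n : ℕ) :
    greedyRem s (n + 1) = 2 * greedyRem s n - bit (greedyBinary s n) := by
  by_cases h : greedyRem s n < 1 / 2
  · simp only [greedyRem, greedyBinary, bit, if_pos h, decide_eq_true_eq, if_neg (not_le.mpr h)]
  · simp only [greedyRem, greedyBinary, bit, if_neg h, decide_eq_true_eq, if_pos (not_lt.mp h)]

theorem greedyRem_mem {s : ℝ} (hs : s ∈ Set.Icc (0 : ℝ) 1) (n : ℕ) :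
    greedyRem s n ∈ Set.Icc (0 : ℝ) 1 := by
  induction n with
  | zero => exact hs
  | succ n ih =>
    obtain ⟨h0, h1⟩ := ih
    by_cases h : greedyRem s n < 1 / 2
    · simp only [greedyRem, if_pos h]
      constructor <;> linarith
    · simp only [greedyRem, if_neg h]
      constructor <;> linarith

theorem greedyBinary_sum (s : ℝ) (n : ℕ) :
    ∑ i ∈ Finset.range n, bit (greedyBinary s i) * ((2 : ℝ) ^ (i + 1))⁻¹
      = s - greedyRem s n * (1 / 2 : ℝ) ^ n := by
  induction n with
  | zero => simp [greedyRem]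
  | succ n ih =>
    rw [Finset.sum_range_succ, ih, greedyRem_succ, ← inv_pow]
    ring

theorem greedyBinary_hasSum {s : ℝ} (hs : s ∈ Set.Icc (0 : ℝ) 1) :
    HasSum (fun i : ℕ => bit (greedyBinary s i) * ((2 : ℝ) ^ (i + 1))⁻¹) s := by
  rw [hasSum_iff_tendsto_nat_of_nonneg]
  · simp only [greedyBinary_sum]
    have h0 : Filter.Tendsto (fun n => greedyRem s n * ((1 / 2 : ℝ)) ^ n) Filter.atTop
        (nhds 0) := by
      refine squeeze_zero (fun n => mul_nonneg (greedyRem_mem hs n).1 (by positivity))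
        (fun n => mul_le_of_le_one_left (by positivity) (greedyRem_mem hs n).2)
        (tendsto_pow_atTop_nhds_zero_of_lt_one (by norm_num) (by norm_num))
    simpa using h0.const_sub s
  · intro i
    unfold bit
    split_ifs <;> positivity

/-- The greedy binary expansion is the lexicographically largest binary expansion. -/
theorem greedyBinary_lexMax {s : ℝ} (z : ℕ → Bool)
    (hz : HasSum (fun i : ℕ => bit (z i) * ((2 : ℝ) ^ (i + 1))⁻¹) s) :
    z = greedyBinary s ∨
      ∃ j, (∀ i < j, z i = greedyBinary s i) ∧ z j = false ∧ greedyBinary s j = true := by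
  by_cases hne : z = greedyBinary s
  · exact Or.inl hne
  right
  have hex : ∃ j, z j ≠ greedyBinary s j := Function.ne_iff.mp hne
  classical
  have hlt : ∀ i < Nat.find hex, z i = greedyBinary s i := fun i hi => by
    simpa using Nat.find_min hex hi
  have hj := Nat.find_spec hex
  set j := Nat.find hex
  refine ⟨j, hlt, ?_⟩
  by_cases hg : greedyBinary s j = true
  · refine ⟨?_, hg⟩
    rw [hg] at hj
    simpa using hj
  exfalso
  have hgf : greedyBinary s j = false := by simpa using hg
  have hzt : z j = true := by
    rw [hgf] at hj
    simpa using hj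
  have hr : greedyRem s j < 1 / 2 := by simpa [greedyBinary] using hgf
  have hle := sum_le_hasSum (Finset.range (j + 1))
    (fun i _ => by unfold bit; split_ifs <;> positivity) hz
  rw [Finset.sum_range_succ, Finset.sum_congr rfl
    (fun i hi => by rw [hlt i (Finset.mem_range.mp hi)]), greedyBinary_sum, hzt, ← inv_pow] at hle
  have hp : (0 : ℝ) < (1 / 2 : ℝ) ^ j := by positivity
  have h2 : bit true * (2⁻¹ : ℝ) ^ (j + 1) = 1 / 2 * (1 / 2 : ℝ) ^ j := by
    simp [bit, pow_succ]
    ring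
  rw [h2] at hle
  nlinarith [mul_lt_mul_of_pos_right hr hp]

/-! ### Lexicographically maximal representatives -/

/-- The class `[x]_β` of the words of the same length and the same value in base `β` as `x`. -/
def betaClass (β : ℝ) (x : List Bool) : Set (List Bool) :=
  {y | y.length = x.length ∧ wordValue β y = wordValue β x}

theorem betaClass_finite (β : ℝ) (x : List Bool) : (betaClass β x).Finite :=
  (List.finite_length_eq Bool x.length).subset fun _ hy => hy.1

theorem betaClass_nonempty (β : ℝ) (x : List Bool) : (betaClass_finite β x).toFinset.Nonempty :=
  ⟨x, by simp [betaClass]⟩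

/-- `M_β(x)`: the largest element of `[x]_β` in the lexicographic order of `List Bool`, where
`false < true`. -/
noncomputable def lexMaxRep (β : ℝ) (x : List Bool) : List Bool :=
  (betaClass_finite β x).toFinset.max' (betaClass_nonempty β x)

/-! ### The minimal polynomial over the integers and the Galois conjugates -/

/-- `P` is a nonzero integer polynomial with root `β`, of minimal degree, with positive leading
coefficient, and with the least leading coefficient among all such polynomials. -/
structure IsIntMinpoly (β : ℝ) (P : ℤ[X]) : Prop where
  root : aeval β P = 0
  degree_min : ∀ Q : ℤ[X], Q ≠ 0 → aeval β Q = 0 → P.natDegree ≤ Q.natDegree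
  lead_pos : 0 < P.leadingCoeff
  lead_min : ∀ Q : ℤ[X], Q ≠ P → Q.natDegree = P.natDegree → 0 < Q.leadingCoeff →
    aeval β Q = 0 → P.leadingCoeff < Q.leadingCoeff

theorem exists_isIntMinpoly {β : ℝ} (h : IsAlgebraic ℤ β) : ∃ P, IsIntMinpoly β P := by
  classical
  obtain ⟨P₀, hP₀, hr₀⟩ := h
  have hd : ∃ d, ∃ Q : ℤ[X], Q ≠ 0 ∧ aeval β Q = 0 ∧ Q.natDegree = d :=
    ⟨_, P₀, hP₀, hr₀, rfl⟩
  have hmin : ∀ Q : ℤ[X], Q ≠ 0 → aeval β Q = 0 → Nat.find hd ≤ Q.natDegree :=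
    fun Q h0 h1 => Nat.find_min' hd ⟨Q, h0, h1, rfl⟩
  have hl : ∃ l : ℕ, ∃ Q : ℤ[X], Q.natDegree = Nat.find hd ∧ aeval β Q = 0 ∧
      0 < Q.leadingCoeff ∧ Q.leadingCoeff = l := by
    obtain ⟨Q, hQ0, hQr, hQd⟩ := Nat.find_spec hd
    rcases lt_trichotomy Q.leadingCoeff 0 with hneg | hz | hpos
    · exact ⟨(-Q.leadingCoeff).toNat, -Q, by simpa using hQd, by simp [hQr], by simpa using hneg,
        by rw [leadingCoeff_neg]; omega⟩
    · exact absurd (leadingCoeff_eq_zero.mp hz) hQ0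
    · exact ⟨Q.leadingCoeff.toNat, Q, hQd, hQr, hpos, by omega⟩
  obtain ⟨P, hPd, hPr, hPpos, hPl⟩ := Nat.find_spec hl
  refine ⟨P, hPr, fun Q h0 h1 => hPd ▸ hmin Q h0 h1, hPpos, fun Q hne hQd hQpos hQr => ?_⟩
  have hle : P.leadingCoeff ≤ Q.leadingCoeff := by
    have := Nat.find_min' hl ⟨Q, hQd.trans hPd, hQr, hQpos, (Int.toNat_of_nonneg hQpos.le).symm⟩
    omega
  refine lt_of_le_of_ne hle fun heq => hne ?_
  by_contra hne'
  have hsub : Q - P ≠ 0 := sub_ne_zero.mpr hne'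
  have hQ0 : Q ≠ 0 := fun h => by simp [h] at hQpos
  have hP0 : P ≠ 0 := fun h => by simp [h] at hPpos
  have hdeg : (Q - P).degree < Q.degree :=
    degree_sub_lt_left (by rw [degree_eq_natDegree hQ0, degree_eq_natDegree hP0, hQd]) hQ0 heq.symm
  have h1 := natDegree_lt_natDegree hsub hdeg
  have h2 := hmin (Q - P) hsub (by simp [hQr, hPr])
  omega

/-- The minimal polynomial `P_β` over the integers of an algebraic number `β`. -/
noncomputable def intMinpoly (β : ℝ) (h : IsAlgebraic ℤ β) : ℤ[X] :=
  (exists_isIntMinpoly h).choose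

theorem intMinpoly_spec (β : ℝ) (h : IsAlgebraic ℤ β) : IsIntMinpoly β (intMinpoly β h) :=
  (exists_isIntMinpoly h).choose_spec

open Classical in
/-- The set `G_β` of Galois conjugates: the complex roots of `P_β` other than `β`. -/
noncomputable def galoisConjugates (β : ℝ) (h : IsAlgebraic ℤ β) : Finset ℂ :=
  ((intMinpoly β h).aroots ℂ).toFinset.erase (β : ℂ)

/-- `∏ |z|` over the Galois conjugates `z` of `β` with `|z| > 1`. -/
noncomputable def outerConjugateProd (β : ℝ) (h : IsAlgebraic ℤ β) : ℝ :=
  ∏ z ∈ galoisConjugates β h with 1 < ‖z‖, ‖z‖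

/-! ### Relative compressibility -/

/-- `K[x | β]`: complexity relative to the greedy binary expansion of `β - 1`. -/
noncomputable def complexityBase (U : (ℕ → Bool) → List Bool →. List Bool) (β : ℝ)
    (x : List Bool) : ℕ :=
  complexity U x (greedyBinary (β - 1))

/-- `n(β) = ⌈n log_β 2⌉`. -/
noncomputable def scaledLength (β : ℝ) (n : ℕ) : ℕ := ⌈(n : ℝ) * Real.logb β 2⌉₊

/-- `(K[w_{1:n(β)} | β] - K[y_{1:n} | β]) / n`, where `w m` is the word of length `m` under
consideration and `y` is the greedy binary expansion of `s`. -/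
noncomputable def complexityGap (U : (ℕ → Bool) → List Bool →. List Bool) (β s : ℝ)
    (w : ℕ → List Bool) (n : ℕ) : ℝ :=
  ((complexityBase U β (w (scaledLength β n)) : ℝ)
    - (complexityBase U β (initWord (greedyBinary s) n) : ℝ)) / n

/-- The limit inferior `Δ̲_β`, in the extended reals. -/
noncomputable def lowerDelta (U : (ℕ → Bool) → List Bool →. List Bool) (β s : ℝ)
    (w : ℕ → List Bool) : EReal :=
  Filter.liminf (fun n : ℕ => (complexityGap U β s w n : EReal)) Filter.atTop

/-- The limit superior `Δ̄_β`, in the extended reals. -/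
noncomputable def upperDelta (U : (ℕ → Bool) → List Bool →. List Bool) (β s : ℝ)
    (w : ℕ → List Bool) : EReal :=
  Filter.limsup (fun n : ℕ => (complexityGap U β s w n : EReal)) Filter.atTop

/-- `M_β x`, as the sequence of words `(M_β x)_{1:n} = M_β(x_{1:n})`. -/
noncomputable def lexMaxSeq (β : ℝ) (x : ℕ → Bool) (n : ℕ) : List Bool :=
  lexMaxRep β (initWord x n)

end BetaExp

/-!
Both inequalities say how many bits are needed to pass between the prefix `y` of length `n` of the
binary expansion of `s` and the representative `w` of length `m = n(β)`, where `2 ^ n ≤ β ^ m`.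
In both directions `O(log n)` bits describe auxiliary parameters, and the oracle supplies rational
approximations to `β` of any desired precision; a universal `U` turns each primitive recursive
decoder into a bound on complexity (`IsUniversal.complexity_decoder_le`).

From `w` to `y`: the value of `w` differs from `s` by at most a constant times `2 ^ (-n)`, so a
truncated approximation of `2 ^ n` times that value, corrected by a bounded integer, is the number
with binary digits `y` (`exists_complexity_binary_le`). This gives the lower bound `0`.

From `y` to `w`: the prefix `y` locates the value of `w` in an interval whose length is a constant
times `2 ^ (-n)`. The difference of the values of two words of length `m` is `β ^ (-m) Q(β)`, where
`Q` has degree less than `m` and coefficients in `{-1, 0, 1}`. If it is nonzero, then so is the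
resultant of `P_β` and `Q`, which is an integer of absolute value
`L ^ m |Q(β)| ∏ |Q(z)|`, the product being over the conjugates `z`. Since `|Q(z)|` is at most
`m max(1, |z|) ^ m`, distinct values are separated by `(β L ∏_{|z| > 1} |z|) ^ (-m)` up to a factor
polynomial in `m` (`wordValue_separation`). Hence `m log₂ (L ∏ |z|) + O(log m)` bits beyond `y`
single out the value of `w`, and `w` itself is the lexicographically largest word of length `m` in a
window around this value (`exists_complexity_rep_le`). As `m / n` tends to `log_β 2`, the number of
extra bits divided by `n` tends to `log_β (L ∏ |z|)`.
-/

namespace BetaExp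

/-! ### Oracle computability -/

theorem OracleRecursive.of_eq {f g : (ℕ → Bool) → ℕ →. ℕ} (hf : OracleRecursive f)
    (h : ∀ o n, f o n = g o n) : OracleRecursive g :=
  (funext fun o => funext (h o) : f = g) ▸ hf

theorem OracleRecursive.of_partrec {f : ℕ →. ℕ} (hf : Nat.Partrec f) :
    OracleRecursive fun _ => f := by
  induction hf with
  | zero => exact .zero
  | succ => exact .succ
  | left => exact .left
  | right => exact .right
  | pair _ _ h₁ h₂ => exact .pair h₁ h₂
  | comp _ _ h₁ h₂ => exact .comp h₁ h₂
  | prec _ _ h₁ h₂ => exact .prec h₁ h₂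
  | rfind _ h => exact .rfind h

theorem OracleRecursive.of_primrec {f : ℕ → ℕ} (hf : Primrec f) :
    OracleRecursive fun _ n => Part.some (f n) :=
  .of_partrec (Nat.Partrec.of_primrec (Primrec.nat_iff.mp hf))

/-- The integer `2 ^ k * (1 + ∑_{i < k} o_i 2^{-i-1})`: the numerator of the approximation with
denominator `2 ^ k` to the number `β ∈ [1, 2]` for which `o` is a binary expansion of `β - 1`. -/
def baseNumerator (o : ℕ → Bool) : ℕ → ℕ
  | 0 => 1
  | k + 1 => 2 * baseNumerator o k + (o k).toNat

theorem oracleRecursive_baseNumerator :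
    OracleRecursive fun o k => Part.some (baseNumerator o k) := by
  have h1 : OracleRecursive fun _ _ => Part.some 1 := .of_primrec (Primrec.const 1)
  have hy : OracleRecursive fun o n => Part.some (o n.unpair.2.unpair.1).toNat :=
    (OracleRecursive.oracle.comp (.of_primrec (f := fun n => n.unpair.2.unpair.1)
      (Primrec.fst.comp (Primrec.unpair.comp (Primrec.snd.comp Primrec.unpair))))).of_eq
      fun o n => by simp
  have hi : OracleRecursive fun _ n => Part.some (2 * n.unpair.2.unpair.2) :=
    .of_primrec (Primrec.nat_mul.comp (Primrec.const 2)
      (Primrec.snd.comp (Primrec.unpair.comp (Primrec.snd.comp Primrec.unpair))))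
  have hadd : OracleRecursive fun _ n => Part.some (n.unpair.1 + n.unpair.2) :=
    .of_primrec (Primrec.nat_add.comp (Primrec.fst.comp Primrec.unpair)
      (Primrec.snd.comp Primrec.unpair))
  have hg : OracleRecursive fun o n =>
      Part.some (2 * n.unpair.2.unpair.2 + (o n.unpair.2.unpair.1).toNat) :=
    (hadd.comp (hi.pair hy)).of_eq fun o n => by simp [Seq.seq]
  have h0 : OracleRecursive fun _ n => Part.some (Nat.pair 0 n) :=
    .of_primrec (Primrec₂.natPair.comp (Primrec.const 0) Primrec.id)
  refine ((h1.prec hg).comp h0).of_eq fun o n => ?_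
  simp only [Part.bind_eq_bind, Part.bind_some, Nat.unpair_pair]
  induction n with
  | zero => simp [baseNumerator]
  | succ n ih => simp only [ih, baseNumerator, Part.bind_some]

/-! ### Words as numbers and the pairing of words -/

/-- The number with binary digits `w`, the most significant digit first. -/
def numeral (w : List Bool) : ℕ := w.foldl (fun a b => 2 * a + b.toNat) 0

theorem numeral_concat (w : List Bool) (b : Bool) :
    numeral (w ++ [b]) = 2 * numeral w + b.toNat := by
  simp [numeral]

theorem exists_numeral_eq {b j : ℕ} (h : j < 2 ^ b) :
    ∃ w : List Bool, w.length = b ∧ numeral w = j := by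
  induction b generalizing j with
  | zero => exact ⟨[], rfl, by simp [numeral]; rw [pow_zero] at h; omega⟩
  | succ b ih =>
    obtain ⟨w, hw, hj⟩ := ih (j := j / 2) (by rw [pow_succ] at h; omega)
    refine ⟨w ++ [decide (j % 2 = 1)], by simp [hw], ?_⟩
    rw [numeral_concat, hj]
    by_cases h2 : j % 2 = 1 <;> simp [h2] <;> omega

/-- The first component of a word `⟨p, x⟩`. -/
def pairFst (z : List Bool) : List Bool :=
  (z.dropWhile id).tail.take (z.takeWhile id).length

/-- The second component of a word `⟨p, x⟩`. -/
def pairSnd (z : List Bool) : List Bool :=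
  (z.dropWhile id).tail.drop (z.takeWhile id).length

@[simp] theorem pairFst_pairWords (p x : List Bool) : pairFst (pairWords p x) = p := by
  simp [pairFst, pairWords]

@[simp] theorem pairSnd_pairWords (p x : List Bool) : pairSnd (pairWords p x) = x := by
  simp [pairSnd, pairWords]

theorem length_pairWords (p x : List Bool) :
    (pairWords p x).length = 2 * p.length + 1 + x.length := by
  simp [pairWords]; omega

theorem primrec_pairFst : Primrec pairFst :=
  Primrec.list_take.comp (Primrec.list_length.comp (Primrec.list_takeWhile Primrec.id))
    (Primrec.list_tail.comp (Primrec.list_dropWhile Primrec.id))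

theorem primrec_pairSnd : Primrec pairSnd :=
  Primrec.list_drop.comp (Primrec.list_length.comp (Primrec.list_takeWhile Primrec.id))
    (Primrec.list_tail.comp (Primrec.list_dropWhile Primrec.id))

theorem primrec_toNat : Primrec Bool.toNat := Primrec.dom_finite _

theorem primrec_numeral : Primrec numeral := by
  refine Primrec.list_foldl (h := fun _ (p : ℕ × Bool) => 2 * p.1 + p.2.toNat) Primrec.id
    (Primrec.const 0) ?_
  exact (Primrec.nat_add.comp
    (Primrec.nat_mul.comp (Primrec.const 2) (Primrec.fst.comp Primrec.snd))
    (primrec_toNat.comp (Primrec.snd.comp Primrec.snd))).to₂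

/-! ### Complexity bounds from decoders -/

section Decoders

variable {U : (ℕ → Bool) → List Bool →. List Bool}

theorem complexity_le_of_mem {o : ℕ → Bool} {q x : List Bool} (h : x ∈ U o q) :
    complexity U x o ≤ q.length :=
  Nat.sInf_le ⟨q, rfl, h⟩

theorem isComputable_id : IsComputable fun _ x => Part.some x := by
  refine OracleRecursive.of_partrec ?_
  have := (Computable.id (α := List Bool)).partrec
  exact this

/-- Every word has a shortest description, since the identity is computable. -/
theorem IsUniversal.exists_program (hU : IsUniversal U) (o : ℕ → Bool) (x : List Bool) :
    ∃ q : List Bool, q.length = complexity U x o ∧ x ∈ U o q := by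
  obtain ⟨p, hp⟩ := hU.2 _ isComputable_id
  have hne : {k | ∃ q : List Bool, q.length = k ∧ x ∈ U o q}.Nonempty :=
    ⟨_, pairWords p x, rfl, by rw [← hp o x]; exact Part.mem_some x⟩
  exact Nat.sInf_mem hne

/-- Postprocessing the output of `U` by a primitive recursive function that may also read the
input and an approximation of the base encoded in the oracle. -/
theorem isComputable_postprocess (hU : IsComputable U) {q : List Bool → List Bool}
    (hq : Primrec q) {k : List Bool → ℕ} (hk : Primrec k)
    {G : List Bool × List Bool × ℕ → List Bool} (hG : Primrec G) :
    IsComputable fun o z => (U o (q z)).map fun x => G (z, x, baseNumerator o (k z)) := by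
  have hA : OracleRecursive fun _ n =>
      Part.bind (Encodable.decode (α := List Bool) n) fun z => Part.some (Encodable.encode (q z)) :=
    .of_partrec hq.to_comp
  have hK : OracleRecursive fun _ n =>
      Part.bind (Encodable.decode (α := List Bool) n) fun z => Part.some (Encodable.encode (k z)) :=
    .of_partrec hk.to_comp
  have hI : OracleRecursive fun _ n => Part.some n := .of_primrec Primrec.id
  have hF : OracleRecursive fun _ n =>
      Part.bind (Encodable.decode (α := List Bool × List Bool × ℕ) n)
        fun z => Part.some (Encodable.encode (G z)) :=
    .of_partrec hG.to_comp
  have hx := OracleRecursive.comp hU hA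
  have hB := oracleRecursive_baseNumerator.comp hK
  refine (hF.comp (hI.pair (hx.pair hB))).of_eq fun o n => ?_
  cases hz : Encodable.decode (α := List Bool) n with
  | none => simp [Seq.seq]
  | some z =>
    simp only [Part.coe_some, Part.bind_some, Part.bind_eq_bind, Encodable.encodek, Seq.seq,
      Part.map_eq_map, Part.map_some, Part.map_bind, Part.bind_map, Encodable.encode_nat,
      Part.bind_assoc, Part.map_map, Encodable.decode_prod_val, Nat.unpair_pair, hz,
      Encodable.decode_nat, Option.bind_some, Option.map_some]
    rw [← Part.bind_some_eq_map]
    congr 1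
    funext x
    simp

/-- A primitive recursive decoder `F` that rebuilds a word from a number `t`, a word `J` whose
length is a function of `t`, a word `x` and an approximation of the base bounds the complexity of
the decoded word: `x` is replaced by a shortest description, and only `t` has to be
self-delimiting. -/
theorem IsUniversal.complexity_decoder_le (hU : IsUniversal U) {ℓ k : ℕ → ℕ} (hℓ : Primrec ℓ)
    (hk : Primrec k) {F : (ℕ × List Bool) × List Bool × ℕ → List Bool} (hF : Primrec F) :
    ∃ c : ℕ, ∀ (o : ℕ → Bool) (t : ℕ) (J x : List Bool), J.length = ℓ t →
      complexity U (F ((t, J), x, baseNumerator o (k t))) o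
        ≤ complexity U x o + J.length + 2 * t.size + c := by
  have ht : Primrec fun z => numeral (pairFst z) := primrec_numeral.comp primrec_pairFst
  have hG : Primrec fun a : List Bool × List Bool × ℕ =>
      F ((numeral (pairFst a.1), (pairSnd a.1).take (ℓ (numeral (pairFst a.1)))), a.2) :=
    hF.comp (((ht.comp Primrec.fst).pair (Primrec.list_take.comp
      (hℓ.comp (ht.comp Primrec.fst)) (primrec_pairSnd.comp Primrec.fst))).pair Primrec.snd)
  have hq : Primrec fun z => (pairSnd z).drop (ℓ (numeral (pairFst z))) :=
    Primrec.list_drop.comp (hℓ.comp ht) primrec_pairSnd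
  obtain ⟨p, hp⟩ := hU.2 _ (isComputable_postprocess hU.1 hq (hk.comp ht) hG)
  refine ⟨2 * p.length + 2, fun o t J x hJ => ?_⟩
  obtain ⟨q, hql, hqx⟩ := hU.exists_program o x
  obtain ⟨h, hhl, hht⟩ := exists_numeral_eq t.lt_size_self
  refine (complexity_le_of_mem (q := pairWords p (pairWords h (J ++ q))) ?_).trans ?_
  · rw [← hp]
    simp only [pairFst_pairWords, pairSnd_pairWords, hht, ← hJ, List.take_left', List.drop_left']
    exact Part.mem_map _ hqx
  · simp only [length_pairWords, List.length_append, hhl, hql]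
    omega

end Decoders

/-! ### Bounded search for the lexicographically largest word -/

/-- The words of length `m` in decreasing lexicographic order. -/
def wordsDesc (m : ℕ) : List (List Bool) :=
  Nat.rec [[]] (fun _ l => l.map (true :: ·) ++ l.map (false :: ·)) m

theorem wordsDesc_succ (m : ℕ) :
    wordsDesc (m + 1) = (wordsDesc m).map (true :: ·) ++ (wordsDesc m).map (false :: ·) := rfl

theorem mem_wordsDesc {m : ℕ} {w : List Bool} : w ∈ wordsDesc m ↔ w.length = m := by
  induction m generalizing w with
  | zero => simp [wordsDesc]
  | succ m ih =>
    rw [wordsDesc_succ]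
    cases w with
    | nil => simp
    | cons c w => cases c <;> simp [ih]

theorem wordsDesc_pairwise (m : ℕ) : (wordsDesc m).Pairwise (· > ·) := by
  induction m with
  | zero => simp [wordsDesc]
  | succ m ih =>
    rw [wordsDesc_succ, List.pairwise_append]
    refine ⟨ih.map _ fun a b h => ?_, ih.map _ fun a b h => ?_, ?_⟩
    · exact List.cons_lt_cons_iff.mpr (Or.inr ⟨rfl, h⟩)
    · exact List.cons_lt_cons_iff.mpr (Or.inr ⟨rfl, h⟩)
    · intro a ha b hb
      obtain ⟨a, -, rfl⟩ := List.mem_map.mp ha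
      obtain ⟨b, -, rfl⟩ := List.mem_map.mp hb
      exact List.cons_lt_cons_iff.mpr (Or.inl (by decide))

/-- The lexicographically largest word of length `m` with the property `p`. -/
def greatestWord (m : ℕ) (p : List Bool → Bool) : List Bool :=
  (wordsDesc m).foldr (fun w r => if p w then w else r) []

theorem greatestWord_eq {m : ℕ} {p : List Bool → Bool} {w : List Bool} (hw : w.length = m)
    (hp : p w) (hmax : ∀ u : List Bool, u.length = m → p u → u ≤ w) : greatestWord m p = w := by
  have key : ∀ l : List (List Bool), l.Pairwise (· > ·) → w ∈ l → (∀ u ∈ l, p u → u ≤ w) →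
      l.foldr (fun w r => if p w then w else r) [] = w := by
    intro l
    induction l with
    | nil => simp
    | cons a l ih =>
      intro hl hwl hm
      rw [List.pairwise_cons] at hl
      rw [List.foldr_cons]
      rcases List.mem_cons.mp hwl with rfl | hwl'
      · rw [if_pos hp]
      · by_cases ha : p a
        · exact absurd (hm a List.mem_cons_self ha) (not_le.mpr (hl.1 w hwl'))
        · rw [if_neg ha]
          exact ih hl.2 hwl' fun u hu => hm u (List.mem_cons_of_mem _ hu)
  exact key _ (wordsDesc_pairwise m) (mem_wordsDesc.mpr hw) fun u hu => hmax u (mem_wordsDesc.mp hu)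

theorem primrec_wordsDesc : Primrec wordsDesc := by
  refine Primrec.nat_rec₁ (f := fun _ (l : List (List Bool)) =>
    l.map (true :: ·) ++ l.map (false :: ·)) [[]] ?_
  exact (Primrec.list_append.comp
    (Primrec.list_map Primrec.snd (Primrec.list_cons.comp (Primrec.const true) Primrec.snd).to₂)
    (Primrec.list_map Primrec.snd
      (Primrec.list_cons.comp (Primrec.const false) Primrec.snd).to₂)).to₂

theorem primrec_greatestWord {α : Type*} [Primcodable α] {m : α → ℕ} {p : α → List Bool → Prop}
    [DecidableRel p] (hm : Primrec m) (hp : PrimrecRel p) :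
    Primrec fun a => greatestWord (m a) fun w => decide (p a w) := by
  have hp' : PrimrecPred fun b : α × List Bool × List Bool => p b.1 b.2.1 :=
    hp.comp Primrec.fst (Primrec.fst.comp Primrec.snd)
  refine (Primrec.list_foldr (h := fun a (q : List Bool × List Bool) =>
    if p a q.1 then q.1 else q.2) (primrec_wordsDesc.comp hm) (Primrec.const [])
    (Primrec.ite hp' (Primrec.fst.comp Primrec.snd)
      (Primrec.snd.comp Primrec.snd)).to₂).of_eq fun a => ?_
  simp [greatestWord]

/-! ### The value of a word at a rational base -/

/-- Numerator and denominator of the value of the word `w` in the rational base `B / K`. -/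
def valueFraction (K B : ℕ) (w : List Bool) : ℕ × ℕ :=
  w.foldr (fun c p => (K * (c.toNat * p.2 + p.1), B * p.2)) (0, 1)

theorem valueFraction_snd (K B : ℕ) (w : List Bool) : (valueFraction K B w).2 = B ^ w.length := by
  induction w with
  | nil => rfl
  | cons c w ih =>
    simp only [valueFraction, List.foldr_cons, List.length_cons] at ih ⊢
    rw [ih, pow_succ']

theorem bit_eq_toNat (b : Bool) : bit b = b.toNat := by cases b <;> simp [bit]

theorem wordValue_cons (γ : ℝ) (c : Bool) (w : List Bool) :
    wordValue γ (c :: w) = (bit c + wordValue γ w) * γ⁻¹ := by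
  unfold wordValue
  rw [add_mul, Finset.sum_mul]
  erw [Fin.sum_univ_succ]
  simp only [List.length_cons, List.get_cons_succ', Fin.val_succ, pow_succ, mul_inv]
  simp [mul_assoc]

theorem valueFraction_fst {K B : ℕ} (hB : B ≠ 0) (w : List Bool) :
    ((valueFraction K B w).1 : ℝ) = wordValue (B / K) w * (valueFraction K B w).2 := by
  have hB' : (B : ℝ) ≠ 0 := by exact_mod_cast hB
  induction w with
  | nil => simp [valueFraction, wordValue]
  | cons c w ih =>
    rw [wordValue_cons, bit_eq_toNat]
    have h : valueFraction K B (c :: w) = (K * (c.toNat * (valueFraction K B w).2 +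
      (valueFraction K B w).1), B * (valueFraction K B w).2) := rfl
    rw [h]
    push_cast
    rw [ih]
    field_simp

theorem primrec_pow {α : Type*} [Primcodable α] {f g : α → ℕ} (hf : Primrec f) (hg : Primrec g) :
    Primrec fun a => f a ^ g a :=
  (Primrec₂.unpaired'.1 Nat.Primrec.pow).comp hf hg

theorem primrec_valueFraction {α : Type*} [Primcodable α] {K B : α → ℕ} {w : α → List Bool}
    (hK : Primrec K) (hB : Primrec B) (hw : Primrec w) :
    Primrec fun a => valueFraction (K a) (B a) (w a) := by
  refine Primrec.list_foldr (h := fun a (q : Bool × ℕ × ℕ) =>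
    (K a * (q.1.toNat * q.2.2 + q.2.1), B a * q.2.2)) hw (Primrec.const (0, 1)) ?_
  have hd : Primrec fun b : α × Bool × ℕ × ℕ => b.2.2.2 :=
    Primrec.snd.comp (Primrec.snd.comp Primrec.snd)
  exact (Primrec.pair
    (Primrec.nat_mul.comp (hK.comp Primrec.fst)
      (Primrec.nat_add.comp
        (Primrec.nat_mul.comp (primrec_toNat.comp (Primrec.fst.comp Primrec.snd)) hd)
        (Primrec.fst.comp (Primrec.snd.comp Primrec.snd))))
    (Primrec.nat_mul.comp (hB.comp Primrec.fst) hd)).to₂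

/-! ### The two decoders -/

/-- The number of binary places of the base that determines the values of all words of length `m`
up to an error of at most `2 ^ (-a)`: the value is `m ^ 2`-Lipschitz in the base, and
`m ^ 2 ≤ 2 ^ (2 * m)`. -/
def precision (a m : ℕ) : ℕ := a + 2 * m

/-- The decoder of binary expansions. With `t = ⟨n, m, d⟩` it returns the binary word of length `n`
of the number `⌊2 ^ n * v⌋ + d - D` if this lies in `[0, 2 ^ n)`, where `v` is the approximate
value of the word `w` (of length `m`). -/
def binaryDecoder (D : ℕ) (a : (ℕ × List Bool) × List Bool × ℕ) : List Bool :=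
  let n := a.1.1.unpair.1
  let m := a.1.1.unpair.2.unpair.1
  let d := a.1.1.unpair.2.unpair.2
  let v := valueFraction (2 ^ precision n m) a.2.2 a.2.1
  greatestWord n fun y => decide ((numeral y + D) * v.2 ≤ 2 ^ n * v.1 + d * v.2)

/-- The number of binary places of the base that `repDecoder` reads for `t = ⟨n, m, b⟩`. -/
def repPrecision (t : ℕ) : ℕ := precision (t.unpair.1 + t.unpair.2.unpair.2) t.unpair.2.unpair.1

/-- The decoder of lexicographically maximal representatives. With `t = ⟨n, m, b⟩` it returns the
largest word of length `m` whose approximate value, scaled by `2 ^ (n + b)`, is within `2` of the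
integer `2 ^ b * y + J - 2 ^ b * D`, where the words `y` and `J` are read as numbers. -/
def repDecoder (D : ℕ) (a : (ℕ × List Bool) × List Bool × ℕ) : List Bool :=
  let n := a.1.1.unpair.1
  let m := a.1.1.unpair.2.unpair.1
  let b := a.1.1.unpair.2.unpair.2
  let v := valueFraction (2 ^ repPrecision a.1.1) a.2.2
  let T := numeral a.2.1 * 2 ^ b + numeral a.1.2
  greatestWord m fun w => decide
    (2 ^ (n + b) * (v w).1 + D * 2 ^ b * (v w).2 ≤ (T + 2) * (v w).2 ∧
      T * (v w).2 ≤ 2 ^ (n + b) * (v w).1 + (D * 2 ^ b + 2) * (v w).2)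

theorem primrec_precision {α : Type*} [Primcodable α] {f g : α → ℕ} (hf : Primrec f)
    (hg : Primrec g) : Primrec fun a => precision (f a) (g a) :=
  Primrec.nat_add.comp hf (Primrec.nat_mul.comp (Primrec.const 2) hg)

theorem primrec_unpair_fst : Primrec fun t : ℕ => t.unpair.1 := Primrec.fst.comp Primrec.unpair

theorem primrec_unpair_snd : Primrec fun t : ℕ => t.unpair.2 := Primrec.snd.comp Primrec.unpair

theorem primrec_repPrecision : Primrec repPrecision :=
  primrec_precision (Primrec.nat_add.comp primrec_unpair_fst
    (primrec_unpair_snd.comp primrec_unpair_snd)) (primrec_unpair_fst.comp primrec_unpair_snd)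

theorem primrec_binaryDecoder (D : ℕ) : Primrec (binaryDecoder D) := by
  have ht : Primrec fun b : ((ℕ × List Bool) × List Bool × ℕ) × List Bool => b.1.1.1 :=
    Primrec.fst.comp (Primrec.fst.comp Primrec.fst)
  have hn := primrec_unpair_fst.comp ht
  have hm := primrec_unpair_fst.comp (primrec_unpair_snd.comp ht)
  have hd := primrec_unpair_snd.comp (primrec_unpair_snd.comp ht)
  have hv := primrec_valueFraction
    (primrec_pow (Primrec.const 2) (primrec_precision hn hm))
    (Primrec.snd.comp (Primrec.snd.comp Primrec.fst) :
      Primrec fun b : ((ℕ × List Bool) × List Bool × ℕ) × List Bool => b.1.2.2)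
    (Primrec.fst.comp (Primrec.snd.comp Primrec.fst))
  unfold binaryDecoder
  refine primrec_greatestWord
    (primrec_unpair_fst.comp (Primrec.fst.comp Primrec.fst)) ?_
  exact Primrec.nat_le.comp
    (Primrec.nat_mul.comp (Primrec.nat_add.comp (primrec_numeral.comp Primrec.snd)
      (Primrec.const D)) (Primrec.snd.comp hv))
    (Primrec.nat_add.comp
      (Primrec.nat_mul.comp (primrec_pow (Primrec.const 2) hn) (Primrec.fst.comp hv))
      (Primrec.nat_mul.comp hd (Primrec.snd.comp hv)))

theorem primrec_repDecoder (D : ℕ) : Primrec (repDecoder D) := by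
  have ht : Primrec fun b : ((ℕ × List Bool) × List Bool × ℕ) × List Bool => b.1.1.1 :=
    Primrec.fst.comp (Primrec.fst.comp Primrec.fst)
  have hn := primrec_unpair_fst.comp ht
  have hb := primrec_unpair_snd.comp (primrec_unpair_snd.comp ht)
  have hv := primrec_valueFraction
    (primrec_pow (Primrec.const 2) (primrec_repPrecision.comp ht))
    (Primrec.snd.comp (Primrec.snd.comp Primrec.fst) :
      Primrec fun b : ((ℕ × List Bool) × List Bool × ℕ) × List Bool => b.1.2.2)
    Primrec.snd
  have hpb := primrec_pow (Primrec.const 2) hb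
  have hl := Primrec.nat_mul.comp (primrec_pow (Primrec.const 2) (Primrec.nat_add.comp hn hb))
    (Primrec.fst.comp hv)
  have hT := Primrec.nat_add.comp
    (Primrec.nat_mul.comp (primrec_numeral.comp (Primrec.fst.comp (Primrec.snd.comp Primrec.fst) :
      Primrec fun b : ((ℕ × List Bool) × List Bool × ℕ) × List Bool => b.1.2.1)) hpb)
    (primrec_numeral.comp (Primrec.snd.comp (Primrec.fst.comp Primrec.fst) :
      Primrec fun b : ((ℕ × List Bool) × List Bool × ℕ) × List Bool => b.1.1.2))
  have hD := Primrec.nat_mul.comp (Primrec.const D) hpb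
  have h2 := Primrec.snd.comp hv
  unfold repDecoder
  refine primrec_greatestWord (primrec_unpair_fst.comp
    (primrec_unpair_snd.comp (Primrec.fst.comp Primrec.fst))) ?_
  exact PrimrecPred.and
    (Primrec.nat_le.comp (Primrec.nat_add.comp hl (Primrec.nat_mul.comp hD h2))
      (Primrec.nat_mul.comp (Primrec.nat_add.comp hT (Primrec.const 2)) h2))
    (Primrec.nat_le.comp (Primrec.nat_mul.comp hT h2)
      (Primrec.nat_add.comp hl
        (Primrec.nat_mul.comp (Primrec.nat_add.comp hD (Primrec.const 2)) h2)))

/-- Criterion for the output of `binaryDecoder`, with the approximate value as a real number. -/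
theorem binaryDecoder_eq {D n m d B : ℕ} {w J y : List Bool} (hB : B ≠ 0) (hy : y.length = n)
    (h : ∀ u : List Bool, (numeral u + D : ℝ) ≤
      2 ^ n * wordValue (B / 2 ^ precision n m) w + d ↔ numeral u ≤ numeral y)
    (hmono : ∀ u : List Bool, u.length = n → numeral u ≤ numeral y → u ≤ y) :
    binaryDecoder D ((Nat.pair n (Nat.pair m d), J), w, B) = y := by
  have hpos : (0 : ℝ) < (valueFraction (2 ^ precision n m) B w).2 := by
    rw [valueFraction_snd]; positivity
  have hiff : ∀ u : List Bool,
      (numeral u + D) * (valueFraction (2 ^ precision n m) B w).2 ≤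
        2 ^ n * (valueFraction (2 ^ precision n m) B w).1 +
          d * (valueFraction (2 ^ precision n m) B w).2 ↔ numeral u ≤ numeral y := fun u => by
    rw [← h u, ← Nat.cast_le (α := ℝ)]
    push_cast
    rw [valueFraction_fst hB, ← mul_assoc, ← add_mul, mul_le_mul_iff_left₀ hpos]
    push_cast
    rfl
  simp only [binaryDecoder, Nat.unpair_pair, hiff]
  exact greatestWord_eq hy (by simp) fun u hu hle => hmono u hu (by simpa using hle)

/-- Criterion for the output of `repDecoder`, with the approximate values as real numbers. -/
theorem repDecoder_eq {D n m b B : ℕ} {w J y : List Bool} (hB : B ≠ 0) (hw : w.length = m)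
    (h : |2 ^ (n + b) * wordValue (B / 2 ^ precision (n + b) m) w -
      (2 ^ b * numeral y + numeral J - 2 ^ b * D)| ≤ 2)
    (hmax : ∀ u : List Bool, u.length = m →
      |2 ^ (n + b) * wordValue (B / 2 ^ precision (n + b) m) u -
        (2 ^ b * numeral y + numeral J - 2 ^ b * D)| ≤ 2 → u ≤ w) :
    repDecoder D ((Nat.pair n (Nat.pair m b), J), y, B) = w := by
  have hiff : ∀ u : List Bool,
      (2 ^ (n + b) * (valueFraction (2 ^ precision (n + b) m) B u).1 +
        D * 2 ^ b * (valueFraction (2 ^ precision (n + b) m) B u).2 ≤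
      (numeral y * 2 ^ b + numeral J + 2) * (valueFraction (2 ^ precision (n + b) m) B u).2 ∧
      (numeral y * 2 ^ b + numeral J) * (valueFraction (2 ^ precision (n + b) m) B u).2 ≤
      2 ^ (n + b) * (valueFraction (2 ^ precision (n + b) m) B u).1 +
        (D * 2 ^ b + 2) * (valueFraction (2 ^ precision (n + b) m) B u).2) ↔
      |2 ^ (n + b) * wordValue (B / 2 ^ precision (n + b) m) u -
        (2 ^ b * numeral y + numeral J - 2 ^ b * D)| ≤ 2 := fun u => by
    have hpos : (0 : ℝ) < (valueFraction (2 ^ precision (n + b) m) B u).2 := by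
      rw [valueFraction_snd]; positivity
    rw [← Nat.cast_le (α := ℝ), ← Nat.cast_le (α := ℝ)]
    push_cast
    rw [valueFraction_fst hB, ← mul_assoc, ← add_mul, ← add_mul, mul_le_mul_iff_left₀ hpos,
      mul_le_mul_iff_left₀ hpos, abs_le]
    push_cast
    constructor
    · rintro ⟨h1, h2⟩
      constructor <;> linarith
    · rintro ⟨h1, h2⟩
      constructor <;> linarith
  simp only [repDecoder, repPrecision, Nat.unpair_pair, hiff]
  exact greatestWord_eq hw (by simpa using h) fun u hu hle => hmax u hu (by simpa using hle)

/-! ### The minimal polynomial over the integers -/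

section Minpoly

variable {β : ℝ} {P : ℤ[X]}

theorem IsIntMinpoly.ne_zero (hP : IsIntMinpoly β P) : P ≠ 0 := fun h => by
  have := hP.lead_pos
  simp [h] at this

theorem IsIntMinpoly.isIntegral (hP : IsIntMinpoly β P) : IsIntegral ℚ β := by
  refine isAlgebraic_iff_isIntegral.mp ⟨P.map (Int.castRingHom ℚ),
    (Polynomial.map_ne_zero_iff Int.cast_injective).mpr hP.ne_zero, ?_⟩
  have := hP.root
  rwa [← aeval_map_algebraMap ℚ] at this

/-- Clearing denominators in the minimal polynomial over `ℚ` gives a competitor in the definition of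
`P_β`, so both have the same degree. -/
theorem IsIntMinpoly.map_eq (hP : IsIntMinpoly β P) :
    P.map (Int.castRingHom ℚ) = C (P.leadingCoeff : ℚ) * minpoly ℚ β := by
  have hinj : Function.Injective (Int.castRingHom ℚ) := Int.cast_injective
  have hr : aeval β (P.map (Int.castRingHom ℚ)) = 0 := by
    have := hP.root
    rwa [← aeval_map_algebraMap ℚ] at this
  have hint := hP.isIntegral
  obtain ⟨b, hb, hbm⟩ := IsLocalization.integerNormalization_spec (nonZeroDivisors ℤ)
    (minpoly ℚ β)
  set M := IsLocalization.integerNormalization (nonZeroDivisors ℤ) (minpoly ℚ β)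
  have hb0 : b ≠ 0 := nonZeroDivisors.ne_zero hb
  have hM : M.map (algebraMap ℤ ℚ) = C (b : ℚ) * minpoly ℚ β := by
    rw [hbm, zsmul_eq_mul, map_intCast]
  have hMd : M.natDegree = (minpoly ℚ β).natDegree := by
    rw [← natDegree_map_eq_of_injective hinj M]
    erw [hM]
    exact natDegree_C_mul (by exact_mod_cast hb0)
  have hM0 : M ≠ 0 := by
    intro h
    rw [h, Polynomial.map_zero] at hM
    exact mul_ne_zero (C_ne_zero.mpr (by exact_mod_cast hb0)) (minpoly.ne_zero hint) hM.symm
  have hMr : aeval β M = 0 := by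
    rw [← aeval_map_algebraMap ℚ, hM, map_mul, minpoly.aeval, mul_zero]
  have hdeg : (P.map (Int.castRingHom ℚ)).natDegree ≤ (minpoly ℚ β).natDegree := by
    rw [natDegree_map_eq_of_injective hinj, ← hMd]
    exact hP.degree_min M hM0 hMr
  have := eq_leadingCoeff_mul_of_monic_of_dvd_of_natDegree_le (minpoly.monic hint)
    (minpoly.dvd ℚ β hr) hdeg
  rwa [leadingCoeff_map_of_injective hinj] at this

theorem IsIntMinpoly.aroots_eq (hP : IsIntMinpoly β P) :
    P.aroots ℂ = (minpoly ℚ β).aroots ℂ := by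
  have h : P.map (algebraMap ℤ ℂ) = (P.map (Int.castRingHom ℚ)).map (algebraMap ℚ ℂ) := by
    rw [Polynomial.map_map]
    congr 1
  rw [aroots, h, hP.map_eq, Polynomial.map_mul, map_C,
    roots_C_mul _ (by simpa using hP.ne_zero)]

/-- A polynomial over the integers that vanishes at a conjugate of `β` vanishes at `β`. -/
theorem IsIntMinpoly.aeval_ne_zero (hP : IsIntMinpoly β P) {Q : ℤ[X]} (hQ : aeval β Q ≠ 0) {z : ℂ}
    (hz : z ∈ P.aroots ℂ) : aeval z Q ≠ 0 := by
  intro h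
  rw [hP.aroots_eq, mem_aroots] at hz
  have hmz : minpoly ℚ β = minpoly ℚ z :=
    minpoly.eq_of_irreducible_of_monic (minpoly.irreducible hP.isIntegral) hz.2
      (minpoly.monic hP.isIntegral)
  rw [← aeval_map_algebraMap ℚ] at h hQ
  obtain ⟨R, hR⟩ := hmz ▸ minpoly.dvd ℚ z h
  exact hQ (by rw [hR, map_mul, minpoly.aeval, zero_mul])

theorem IsIntMinpoly.aroots_nodup (hP : IsIntMinpoly β P) : (P.aroots ℂ).Nodup := by
  rw [hP.aroots_eq]
  exact nodup_roots (minpoly.irreducible hP.isIntegral).separable.map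

theorem IsIntMinpoly.mem_aroots_self (hP : IsIntMinpoly β P) : (β : ℂ) ∈ P.aroots ℂ := by
  rw [mem_aroots]
  refine ⟨hP.ne_zero, ?_⟩
  have := congrArg (algebraMap ℝ ℂ) hP.root
  rwa [← aeval_algebraMap_apply, map_zero] at this

end Minpoly

/-- The resultant of `P_β` and `Q` is a nonzero integer, which bounds the product of the values of
`Q` at `β` and at its conjugates from below. -/
theorem one_le_lead_pow_mul_prod (β : ℝ) (halg : IsAlgebraic ℤ β) {Q : ℤ[X]} (hQ : aeval β Q ≠ 0)
    {m : ℕ} (hm : Q.natDegree ≤ m) :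
    1 ≤ ((intMinpoly β halg).leadingCoeff : ℝ) ^ m * |aeval β Q| *
      ∏ z ∈ galoisConjugates β halg, ‖aeval z Q‖ := by
  classical
  have hP := intMinpoly_spec β halg
  set P := intMinpoly β halg with hPdef
  have hinj : Function.Injective (algebraMap ℤ ℂ) := (algebraMap ℤ ℂ).injective_int
  have hres := resultant_eq_prod_eval (P.map (algebraMap ℤ ℂ)) (Q.map (algebraMap ℤ ℂ)) m
    (natDegree_map_le.trans hm) (IsAlgClosed.splits _)
  rw [natDegree_map_eq_of_injective hinj, resultant_map_map,
    leadingCoeff_map_of_injective hinj] at hres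
  have hprod : ((P.map (algebraMap ℤ ℂ)).roots.map (Q.map (algebraMap ℤ ℂ)).eval).prod =
      aeval (β : ℂ) Q * ∏ z ∈ galoisConjugates β halg, aeval z Q := by
    have h1 : ((P.aroots ℂ).toFinset).val = P.aroots ℂ := by
      rw [Multiset.toFinset_val, hP.aroots_nodup.dedup]
    change ((P.aroots ℂ).map _).prod = _
    rw [← h1, galoisConjugates, ← hPdef]
    have := Finset.mul_prod_erase (P.aroots ℂ).toFinset (fun z => aeval z Q)
      (Multiset.mem_toFinset.mpr hP.mem_aroots_self)
    simp only [eval_map_algebraMap]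
    exact this.symm
  rw [hprod] at hres
  have hβ : aeval (β : ℂ) Q = ((aeval β Q : ℝ) : ℂ) :=
    aeval_algebraMap_apply (A := ℝ) ℂ β Q
  have hne : resultant P Q P.natDegree m ≠ 0 := by
    intro h
    rw [h, map_zero, eq_comm, mul_eq_zero, mul_eq_zero] at hres
    rcases hres with h | h | h
    · exact hP.ne_zero (by simpa using eq_zero_of_pow_eq_zero h)
    · exact hQ (by rw [hβ] at h; exact_mod_cast h)
    · obtain ⟨z, hz, h0⟩ := Finset.prod_eq_zero_iff.mp h
      exact hP.aeval_ne_zero hQ (Multiset.mem_toFinset.mp (Finset.mem_of_mem_erase hz)) h0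
  have h1 : (1 : ℝ) ≤ ‖algebraMap ℤ ℂ (resultant P Q P.natDegree m)‖ := by
    rw [eq_intCast, Complex.norm_intCast]
    exact_mod_cast Int.one_le_abs hne
  rw [hres] at h1
  have hL : ‖algebraMap ℤ ℂ P.leadingCoeff‖ = (P.leadingCoeff : ℝ) := by
    rw [eq_intCast, Complex.norm_intCast, abs_of_pos]
    exact_mod_cast hP.lead_pos
  rw [norm_mul, norm_mul, norm_pow, norm_prod, hβ, Complex.norm_real, Real.norm_eq_abs, hL] at h1
  rwa [mul_assoc]

/-! ### Separation of the values of words -/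

/-- The polynomial `∑ w_i X ^ (|w| - i)`, whose value at `β` is `β ^ |w|` times that of `w`. -/
noncomputable def wordPoly : List Bool → ℤ[X]
  | [] => 0
  | c :: w => C (c.toNat : ℤ) * X ^ w.length + wordPoly w

theorem natDegree_wordPoly_le (w : List Bool) : (wordPoly w).natDegree ≤ w.length := by
  induction w with
  | nil => simp [wordPoly]
  | cons c w ih =>
    refine (natDegree_add_le _ _).trans (max_le ?_ (ih.trans (by simp)))
    exact (natDegree_C_mul_X_pow_le _ _).trans (by simp)

theorem aeval_wordPoly {β : ℝ} (hβ : β ≠ 0) (w : List Bool) :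
    aeval β (wordPoly w) = β ^ w.length * wordValue β w := by
  induction w with
  | nil => simp [wordPoly, wordValue]
  | cons c w ih =>
    rw [wordPoly, map_add, ih, wordValue_cons, bit_eq_toNat, List.length_cons, pow_succ]
    simp
    field_simp

theorem norm_aeval_wordPoly_sub_le {m : ℕ} {w u : List Bool} (hw : w.length = m)
    (hu : u.length = m) (z : ℂ) :
    ‖aeval z (wordPoly w - wordPoly u)‖ ≤ ∑ i ∈ Finset.range m, ‖z‖ ^ i := by
  induction m generalizing w u with
  | zero =>
    rw [List.length_eq_zero_iff] at hw hu
    simp [hw, hu]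
  | succ m ih =>
    obtain ⟨c, w, rfl⟩ := List.exists_cons_of_length_eq_add_one hw
    obtain ⟨d, u, rfl⟩ := List.exists_cons_of_length_eq_add_one hu
    simp only [List.length_cons, Nat.add_right_cancel_iff] at hw hu
    have h : aeval z (wordPoly (c :: w) - wordPoly (d :: u)) =
        aeval z (wordPoly w - wordPoly u) + ((c.toNat : ℂ) - d.toNat) * z ^ m := by
      simp [wordPoly, hw, hu]
      ring
    have hcd : ‖(c.toNat : ℂ) - d.toNat‖ ≤ 1 := by cases c <;> cases d <;> simp
    rw [h, Finset.sum_range_succ]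
    refine (norm_add_le _ _).trans (add_le_add (ih hw hu) ?_)
    rw [norm_mul, norm_pow]
    exact mul_le_of_le_one_left (by positivity) hcd

/-- Distinct values of words of length `m` in base `β` differ by at least
`(β L ∏ |z|) ^ (-m)` up to a factor that is polynomial in `m`. -/
theorem wordValue_separation {β : ℝ} (hβ : 1 < β) (halg : IsAlgebraic ℤ β) {m : ℕ}
    {w u : List Bool} (hw : w.length = m) (hu : u.length = m)
    (hne : wordValue β w ≠ wordValue β u) :
    1 ≤ β ^ m * |wordValue β w - wordValue β u| * m ^ (galoisConjugates β halg).card *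
      ((intMinpoly β halg).leadingCoeff * outerConjugateProd β halg) ^ m := by
  have h0 : β ≠ 0 := by positivity
  have hP := intMinpoly_spec β halg
  have hL : (0 : ℝ) < (intMinpoly β halg).leadingCoeff := by exact_mod_cast hP.lead_pos
  have hval : aeval β (wordPoly w - wordPoly u) = β ^ m * (wordValue β w - wordValue β u) := by
    rw [map_sub, aeval_wordPoly h0, aeval_wordPoly h0, hw, hu, mul_sub]
  have hQ : aeval β (wordPoly w - wordPoly u) ≠ 0 := by
    rw [hval]
    exact mul_ne_zero (pow_ne_zero _ h0) (sub_ne_zero.mpr hne)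
  have hdeg : (wordPoly w - wordPoly u).natDegree ≤ m :=
    (natDegree_sub_le _ _).trans (max_le (hw ▸ natDegree_wordPoly_le w)
      (hu ▸ natDegree_wordPoly_le u))
  refine (one_le_lead_pow_mul_prod β halg hQ hdeg).trans ?_
  have hprod : ∏ z ∈ galoisConjugates β halg, ‖aeval z (wordPoly w - wordPoly u)‖ ≤
      m ^ (galoisConjugates β halg).card * outerConjugateProd β halg ^ m := by
    rw [outerConjugateProd, Finset.prod_filter, ← Finset.prod_pow, ← Finset.prod_const,
      ← Finset.prod_mul_distrib]
    refine Finset.prod_le_prod (fun _ _ => norm_nonneg _) fun z _ => ?_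
    refine (norm_aeval_wordPoly_sub_le hw hu z).trans ?_
    have : ∀ i ∈ Finset.range m, ‖z‖ ^ i ≤ (if 1 < ‖z‖ then ‖z‖ else 1) ^ m := fun i hi => by
      split_ifs with h
      · exact pow_le_pow_right₀ h.le (Finset.mem_range.mp hi).le
      · rw [one_pow]
        exact pow_le_one₀ (norm_nonneg _) (not_lt.mp h)
    simpa using Finset.sum_le_card_nsmul _ _ _ this
  rw [hval, abs_mul, abs_of_pos (by positivity : (0 : ℝ) < β ^ m)]
  calc _ ≤ ((intMinpoly β halg).leadingCoeff : ℝ) ^ m *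
        (β ^ m * |wordValue β w - wordValue β u|) *
        (m ^ (galoisConjugates β halg).card * outerConjugateProd β halg ^ m) := by gcongr
    _ = _ := by ring

theorem one_le_lead_mul_outerConjugateProd (β : ℝ) (halg : IsAlgebraic ℤ β) :
    1 ≤ ((intMinpoly β halg).leadingCoeff : ℝ) * outerConjugateProd β halg := by
  have hL : (1 : ℝ) ≤ (intMinpoly β halg).leadingCoeff := by
    exact_mod_cast (intMinpoly_spec β halg).lead_pos
  have hp : 1 ≤ outerConjugateProd β halg :=
    Finset.one_le_prod fun z hz => (Finset.mem_filter.mp hz).2.le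
  exact one_le_mul_of_one_le_of_one_le hL hp

/-! ### Values of words and prefixes -/

theorem bit_nonneg (b : Bool) : 0 ≤ bit b := by cases b <;> simp [bit]

theorem bit_le_one (b : Bool) : bit b ≤ 1 := by cases b <;> simp [bit]

theorem wordValue_nil (γ : ℝ) : wordValue γ [] = 0 := by simp [wordValue]

theorem wordValue_concat {γ : ℝ} (w : List Bool) (b : Bool) :
    wordValue γ (w ++ [b]) = wordValue γ w + bit b * (γ ^ (w.length + 1))⁻¹ := by
  induction w with
  | nil => simp [wordValue_cons, wordValue_nil]
  | cons c w ih =>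
    rw [List.cons_append, wordValue_cons, wordValue_cons, ih, List.length_cons,
      pow_succ _ (w.length + 1), mul_inv]
    ring

theorem wordValue_nonneg {γ : ℝ} (hγ : 0 ≤ γ) (w : List Bool) : 0 ≤ wordValue γ w :=
  Finset.sum_nonneg fun _ _ => mul_nonneg (bit_nonneg _) (by positivity)

theorem wordValue_le_length {γ : ℝ} (hγ : 1 ≤ γ) (w : List Bool) :
    wordValue γ w ≤ w.length := by
  have : ∀ i ∈ (Finset.univ : Finset (Fin w.length)),
      bit (w.get i) * (γ ^ (i.val + 1))⁻¹ ≤ 1 := fun i _ =>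
    mul_le_one₀ (bit_le_one _) (by positivity) (inv_le_one_of_one_le₀ (one_le_pow₀ hγ))
  simpa [wordValue] using Finset.sum_le_card_nsmul _ _ _ this

/-- The value of a word is a Lipschitz function of the base. -/
theorem abs_wordValue_sub_le {β γ : ℝ} (hβ : 1 ≤ β) (hγ : 1 ≤ γ) (w : List Bool) :
    |wordValue γ w - wordValue β w| ≤ w.length ^ 2 * |γ - β| := by
  induction w with
  | nil => simp [wordValue_nil]
  | cons c w ih =>
    have hγ0 : 0 < γ := by linarith
    have hβ0 : 0 < β := by linarith
    have hγi : γ⁻¹ ≤ 1 := inv_le_one_of_one_le₀ hγ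
    have hinv : |γ⁻¹ - β⁻¹| ≤ |γ - β| := by
      rw [inv_sub_inv hγ0.ne' hβ0.ne', abs_div, abs_sub_comm,
        abs_of_pos (mul_pos hγ0 hβ0)]
      exact div_le_self (abs_nonneg _) (by nlinarith)
    have h0 := wordValue_nonneg hβ0.le w
    have hl := wordValue_le_length hβ w
    have hb0 := bit_nonneg c
    have hb1 := bit_le_one c
    have hsplit : wordValue γ (c :: w) - wordValue β (c :: w) =
        (wordValue γ w - wordValue β w) * γ⁻¹ + (bit c + wordValue β w) * (γ⁻¹ - β⁻¹) := by
      rw [wordValue_cons, wordValue_cons]; ring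
    have h1 : |(wordValue γ w - wordValue β w) * γ⁻¹| ≤ w.length ^ 2 * |γ - β| := by
      rw [abs_mul, abs_of_pos (inv_pos.mpr hγ0)]
      exact (mul_le_of_le_one_right (abs_nonneg _) hγi).trans ih
    have h2 : |(bit c + wordValue β w) * (γ⁻¹ - β⁻¹)| ≤ (1 + w.length) * |γ - β| := by
      rw [abs_mul, abs_of_nonneg (add_nonneg hb0 h0)]
      exact mul_le_mul (add_le_add hb1 hl) hinv (abs_nonneg _) (by positivity)
    have h3 := abs_nonneg (γ - β)
    have h4 : (0 : ℝ) ≤ w.length * |γ - β| := by positivity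
    rw [hsplit, List.length_cons]
    refine (abs_add_le _ _).trans ((add_le_add h1 h2).trans ?_)
    push_cast
    nlinarith

theorem initWord_succ (x : ℕ → Bool) (n : ℕ) : initWord x (n + 1) = initWord x n ++ [x n] := by
  rw [initWord, List.ofFn_succ_last]
  simp [initWord]

theorem length_initWord (x : ℕ → Bool) (n : ℕ) : (initWord x n).length = n := by simp [initWord]

theorem wordValue_initWord (γ : ℝ) (x : ℕ → Bool) (n : ℕ) :
    wordValue γ (initWord x n) = ∑ i ∈ Finset.range n, bit (x i) * (γ ^ (i + 1))⁻¹ := by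
  induction n with
  | zero => simp [initWord, wordValue_nil]
  | succ n ih => rw [initWord_succ, wordValue_concat, ih, length_initWord, Finset.sum_range_succ]

theorem summable_seqValue {β : ℝ} (hβ : 1 < β) (x : ℕ → Bool) :
    Summable fun i : ℕ => bit (x i) * (β ^ (i + 1))⁻¹ := by
  have hg : Summable fun i : ℕ => (β⁻¹) ^ i :=
    summable_geometric_of_lt_one (by positivity) (inv_lt_one_of_one_lt₀ hβ)
  refine Summable.of_nonneg_of_le (fun i => mul_nonneg (bit_nonneg _) (by positivity))
    (fun i => ?_) ((summable_nat_add_iff 1).mpr hg)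
  rw [inv_pow]
  exact mul_le_of_le_one_left (by positivity) (bit_le_one _)

theorem seqValue_nonneg {β : ℝ} (hβ : 1 < β) (x : ℕ → Bool) : 0 ≤ seqValue β x :=
  tsum_nonneg fun _ => mul_nonneg (bit_nonneg _) (by positivity)

theorem wordValue_initWord_le {β : ℝ} (hβ : 1 < β) (x : ℕ → Bool) (m : ℕ) :
    wordValue β (initWord x m) ≤ seqValue β x := by
  rw [wordValue_initWord]
  exact (summable_seqValue hβ x).sum_le_tsum _
    fun _ _ => mul_nonneg (bit_nonneg _) (by positivity)

theorem seqValue_le_add {β : ℝ} (hβ : 1 < β) (x : ℕ → Bool) (m : ℕ) :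
    seqValue β x ≤ wordValue β (initWord x m) + (β ^ m)⁻¹ * (β - 1)⁻¹ := by
  have hβ0 : 0 < β := by linarith
  have hβ1 : 0 < β - 1 := by linarith
  rw [wordValue_initWord]
  have hnn : ∀ i, 0 ≤ bit (x i) * (β ^ (i + 1))⁻¹ :=
    fun _ => mul_nonneg (bit_nonneg _) (by positivity)
  have key : ∀ j, ∑ i ∈ Finset.range (m + j), bit (x i) * (β ^ (i + 1))⁻¹ ≤
      ∑ i ∈ Finset.range m, bit (x i) * (β ^ (i + 1))⁻¹ +
        ((β ^ m)⁻¹ - (β ^ (m + j))⁻¹) * (β - 1)⁻¹ := by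
    intro j
    induction j with
    | zero => simp
    | succ j ih =>
      rw [← add_assoc, Finset.sum_range_succ]
      have h1 : bit (x (m + j)) * (β ^ (m + j + 1))⁻¹ ≤ (β ^ (m + j + 1))⁻¹ :=
        mul_le_of_le_one_left (by positivity) (bit_le_one _)
      have h2 : ((β ^ (m + j))⁻¹ - (β ^ (m + j + 1))⁻¹) * (β - 1)⁻¹ = (β ^ (m + j + 1))⁻¹ := by
        rw [pow_succ]
        field_simp
      linarith
  refine Real.tsum_le_of_sum_range_le hnn fun j => ?_
  refine (Finset.sum_le_sum_of_subset_of_nonneg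
    (Finset.range_mono (Nat.le_add_left j m)) fun i _ _ => hnn i).trans ((key j).trans ?_)
  gcongr
  have : 0 ≤ (β ^ (m + j))⁻¹ := by positivity
  linarith

/-! ### Numerals and greedy expansions -/

theorem numeral_cons (c : Bool) (w : List Bool) :
    numeral (c :: w) = c.toNat * 2 ^ w.length + numeral w := by
  induction w using List.reverseRecOn with
  | nil => simp [numeral]
  | append_singleton w b ih =>
    rw [← List.cons_append, numeral_concat, ih, numeral_concat, List.length_append, pow_add]
    simp
    ring

theorem numeral_lt (w : List Bool) : numeral w < 2 ^ w.length := by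
  induction w with
  | nil => simp [numeral]
  | cons c w ih =>
    have := Bool.toNat_le c
    rw [numeral_cons, List.length_cons, pow_succ]
    nlinarith

theorem numeral_lt_numeral {n : ℕ} {w u : List Bool} (hw : w.length = n) (hu : u.length = n)
    (h : w < u) : numeral w < numeral u := by
  induction n generalizing w u with
  | zero =>
    rw [List.length_eq_zero_iff] at hw hu
    simp [hw, hu] at h
  | succ n ih =>
    obtain ⟨c, w, rfl⟩ := List.exists_cons_of_length_eq_add_one hw
    obtain ⟨d, u, rfl⟩ := List.exists_cons_of_length_eq_add_one hu
    simp only [List.length_cons, Nat.add_right_cancel_iff] at hw hu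
    rw [numeral_cons, numeral_cons, hw, hu]
    rcases List.cons_lt_cons_iff.mp h with h | ⟨rfl, h'⟩
    · obtain ⟨rfl, rfl⟩ : c = false ∧ d = true := by revert h; cases c <;> cases d <;> decide
      have := numeral_lt w
      rw [hw] at this
      simp
      omega
    · have := ih hw hu h'
      omega

theorem le_of_numeral_le {n : ℕ} {w u : List Bool} (hw : w.length = n) (hu : u.length = n)
    (h : numeral u ≤ numeral w) : u ≤ w :=
  not_lt.mp fun hlt => absurd (numeral_lt_numeral hw hu hlt) (not_lt.mpr h)

theorem numeral_initWord_greedyBinary (s : ℝ) (n : ℕ) :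
    (numeral (initWord (greedyBinary s) n) : ℝ) = 2 ^ n * s - greedyRem s n := by
  induction n with
  | zero => simp [initWord, numeral, greedyRem]
  | succ n ih =>
    rw [initWord_succ, numeral_concat, greedyRem_succ, bit_eq_toNat]
    push_cast
    rw [ih]
    ring

theorem baseNumerator_greedyBinary (β : ℝ) (k : ℕ) :
    (baseNumerator (greedyBinary (β - 1)) k : ℝ) = 2 ^ k * β - greedyRem (β - 1) k := by
  induction k with
  | zero => simp [baseNumerator, greedyRem]
  | succ k ih =>
    rw [baseNumerator, greedyRem_succ, bit_eq_toNat]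
    push_cast
    rw [ih]
    ring

theorem two_pow_le_baseNumerator (o : ℕ → Bool) (k : ℕ) : 2 ^ k ≤ baseNumerator o k := by
  induction k with
  | zero => simp [baseNumerator]
  | succ k ih => rw [baseNumerator, pow_succ]; omega

theorem baseNumerator_ne_zero (o : ℕ → Bool) (k : ℕ) : baseNumerator o k ≠ 0 :=
  ((Nat.two_pow_pos k).trans_le (two_pow_le_baseNumerator o k)).ne'

/-- With the approximation of the base of the chosen precision, the scaled values of all words of
length `m` are correct up to `1`. -/
theorem abs_wordValue_approx_le {β : ℝ} (hβ : β ∈ Set.Ioo (1 : ℝ) 2) {w : List Bool} (a : ℕ) :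
    |2 ^ a * wordValue (baseNumerator (greedyBinary (β - 1)) (precision a w.length) /
      2 ^ precision a w.length) w - 2 ^ a * wordValue β w| ≤ 1 := by
  set k := precision a w.length with hk
  set γ : ℝ := baseNumerator (greedyBinary (β - 1)) k / 2 ^ k
  have hk0 : (0 : ℝ) < 2 ^ k := by positivity
  have hγ : 1 ≤ γ := (one_le_div hk0).mpr (by exact_mod_cast two_pow_le_baseNumerator _ k)
  have hrem := greedyRem_mem (s := β - 1) ⟨by linarith [hβ.1], by linarith [hβ.2]⟩ k
  have hd : |γ - β| ≤ 1 / 2 ^ k := by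
    have : γ - β = -(greedyRem (β - 1) k / 2 ^ k) := by
      simp only [γ, baseNumerator_greedyBinary]
      field_simp
      ring
    rw [this, abs_neg, abs_of_nonneg (div_nonneg hrem.1 hk0.le)]
    gcongr
    exact hrem.2
  rw [← mul_sub, abs_mul, abs_of_pos (by positivity : (0 : ℝ) < 2 ^ a)]
  have hl : (w.length : ℝ) ≤ 2 ^ w.length := by exact_mod_cast Nat.lt_two_pow_self.le
  calc (2 : ℝ) ^ a * |wordValue γ w - wordValue β w|
      ≤ 2 ^ a * ((2 ^ w.length) ^ 2 * (1 / 2 ^ k)) := by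
        gcongr
        exact (abs_wordValue_sub_le hβ.1.le hγ w).trans (by gcongr)
    _ = 1 := by
        rw [hk, precision, pow_add, pow_mul']
        field_simp

/-! ### Maximal representatives -/

theorem lexMaxRep_mem (β : ℝ) (x : List Bool) : lexMaxRep β x ∈ betaClass β x := by
  have := Finset.max'_mem _ (betaClass_nonempty β x)
  rwa [Set.Finite.mem_toFinset] at this

theorem le_lexMaxRep {β : ℝ} {x u : List Bool} (hu : u ∈ betaClass β x) : u ≤ lexMaxRep β x :=
  Finset.le_max' _ _ ((Set.Finite.mem_toFinset _).mpr hu)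

theorem two_pow_le_pow_scaledLength {β : ℝ} (hβ : 1 < β) (n : ℕ) :
    (2 : ℝ) ^ n ≤ β ^ scaledLength β n := by
  have hβ0 : 0 < β := by linarith
  have h : (n : ℝ) * Real.logb β 2 ≤ scaledLength β n := Nat.le_ceil _
  have h2 : (2 : ℝ) ^ n = β ^ ((n : ℝ) * Real.logb β 2) := by
    rw [mul_comm, Real.rpow_mul hβ0.le, Real.rpow_logb hβ0 hβ.ne' two_pos, Real.rpow_natCast]
  rw [h2, ← Real.rpow_natCast]
  exact Real.rpow_le_rpow_of_exponent_le hβ.le h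

theorem pow_scaledLength_le {β : ℝ} (hβ : 1 < β) (n : ℕ) :
    β ^ scaledLength β n ≤ β * 2 ^ n := by
  have hβ0 : 0 < β := by linarith
  have hl : 0 < Real.logb β 2 := Real.logb_pos hβ one_lt_two
  have h : (scaledLength β n : ℝ) ≤ n * Real.logb β 2 + 1 :=
    (Nat.ceil_lt_add_one (by positivity)).le
  have h2 : (2 : ℝ) ^ n = β ^ ((n : ℝ) * Real.logb β 2) := by
    rw [mul_comm, Real.rpow_mul hβ0.le, Real.rpow_logb hβ0 hβ.ne' two_pos, Real.rpow_natCast]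
  rw [h2, ← Real.rpow_natCast]
  refine (Real.rpow_le_rpow_of_exponent_le hβ.le h).trans ?_
  rw [Real.rpow_add hβ0, Real.rpow_one, mul_comm]

/-! ### The two complexity estimates -/

section Estimates

variable {U : (ℕ → Bool) → List Bool →. List Bool} {β : ℝ}

/-- Since `2 ^ n ≤ β ^ n(β)`, the tail of the series beyond `n(β)` is at most
`2 ^ (-n) / (β - 1)`. -/
theorem wordValue_lexMaxSeq_bounds (hβ : 1 < β) (x : ℕ → Bool) (n : ℕ) :
    2 ^ n * wordValue β (lexMaxSeq β x (scaledLength β n)) ≤ 2 ^ n * seqValue β x ∧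
      2 ^ n * seqValue β x ≤
        2 ^ n * wordValue β (lexMaxSeq β x (scaledLength β n)) + (β - 1)⁻¹ := by
  have hβ1 : 0 < (β - 1)⁻¹ := inv_pos.mpr (by linarith)
  have hv : wordValue β (lexMaxSeq β x (scaledLength β n)) =
      wordValue β (initWord x (scaledLength β n)) := (lexMaxRep_mem _ _).2
  rw [hv]
  refine ⟨by gcongr; exact wordValue_initWord_le hβ x _, ?_⟩
  have h := seqValue_le_add hβ x (scaledLength β n)
  have h2 : (2 : ℝ) ^ n * (β ^ scaledLength β n)⁻¹ ≤ 1 := by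
    rw [← div_eq_mul_inv]
    exact div_le_one_of_le₀ (two_pow_le_pow_scaledLength hβ n) (by positivity)
  calc 2 ^ n * seqValue β x ≤ 2 ^ n * (wordValue β (initWord x (scaledLength β n)) +
        (β ^ scaledLength β n)⁻¹ * (β - 1)⁻¹) := by gcongr
    _ = 2 ^ n * wordValue β (initWord x (scaledLength β n)) +
        (2 ^ n * (β ^ scaledLength β n)⁻¹) * (β - 1)⁻¹ := by ring
    _ ≤ _ := by
        gcongr
        exact mul_le_of_le_one_left hβ1.le h2

theorem length_lexMaxSeq (β : ℝ) (x : ℕ → Bool) (m : ℕ) : (lexMaxSeq β x m).length = m :=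
  (lexMaxRep_mem β (initWord x m)).1.trans (length_initWord x m)

theorem size_pair_pair_le (a b c : ℕ) :
    (Nat.pair a (Nat.pair b c)).size ≤ 4 * (a + b + c + 1).size := by
  rw [Nat.size_le, mul_comm, pow_mul]
  have h1 : Nat.pair b c < (a + b + c + 1) ^ 2 :=
    (Nat.pair_lt_max_add_one_sq b c).trans_le (Nat.pow_le_pow_left (by omega) 2)
  have h2 : a < (a + b + c + 1) ^ 2 :=
    (by omega : a < a + b + c + 1).trans_le (Nat.le_self_pow two_ne_zero _)
  calc Nat.pair a (Nat.pair b c) < (max a (Nat.pair b c) + 1) ^ 2 := Nat.pair_lt_max_add_one_sq _ _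
    _ ≤ ((a + b + c + 1) ^ 2) ^ 2 := Nat.pow_le_pow_left (by omega) 2
    _ = (a + b + c + 1) ^ 4 := by ring
    _ ≤ _ := Nat.pow_le_pow_left (Nat.lt_size_self _).le 4

/-- The prefix of length `n` of the binary expansion of `s` can be computed from the
representative of length `n(β)` and `O(log n)` further bits. -/
theorem exists_complexity_binary_le (hU : IsUniversal U) (hβ : β ∈ Set.Ioo (1 : ℝ) 2)
    {x : ℕ → Bool} (hx : x ∈ Omega β) :
    ∃ c : ℕ, ∀ n : ℕ, complexityBase U β (initWord (greedyBinary (seqValue β x)) n) ≤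
      complexityBase U β (lexMaxSeq β x (scaledLength β n)) +
        8 * (n + scaledLength β n + c + 1).size + c := by
  -- `D` exceeds the truncation errors, so that the offset below is a natural number
  set D : ℕ := ⌈(β - 1)⁻¹⌉₊ + 2 with hDdef
  have hD : (β - 1)⁻¹ + 2 ≤ D := by
    rw [hDdef]; push_cast; linarith [Nat.le_ceil (β - 1)⁻¹]
  have hβ1 : 0 < (β - 1)⁻¹ := inv_pos.mpr (by linarith [hβ.1])
  obtain ⟨c, hc⟩ := hU.complexity_decoder_le (ℓ := fun _ => 0)
    (k := fun t => precision t.unpair.1 t.unpair.2.unpair.1) (Primrec.const 0)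
    (primrec_precision primrec_unpair_fst (primrec_unpair_fst.comp primrec_unpair_snd))
    (primrec_binaryDecoder D)
  refine ⟨max c (2 * D), fun n => ?_⟩
  set o := greedyBinary (β - 1) with ho
  set y := initWord (greedyBinary (seqValue β x)) n with hy
  set m := scaledLength β n
  set w := lexMaxSeq β x m
  have hwl : w.length = m := length_lexMaxSeq β x m
  obtain ⟨hv1, hv2⟩ := wordValue_lexMaxSeq_bounds hβ.1 x n
  have hrem := greedyRem_mem (s := seqValue β x) ⟨seqValue_nonneg hβ.1 x, hx⟩ n
  have hnum := numeral_initWord_greedyBinary (seqValue β x) n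
  have happ := abs_le.mp (abs_wordValue_approx_le hβ (w := w) n)
  rw [hwl] at happ
  set B := baseNumerator o (precision n m) with hB
  set v : ℝ := wordValue (B / 2 ^ precision n m) w
  rw [← hy] at hnum
  have hf1 := Int.floor_le (2 ^ n * v)
  have hf2 := Int.lt_floor_add_one (2 ^ n * v)
  -- `d` corrects the truncated approximate value to the truncated value of `s`
  obtain ⟨d, hd⟩ : ∃ d : ℕ, (d : ℤ) = numeral y + D - ⌊2 ^ n * v⌋ := by
    refine Int.eq_ofNat_of_zero_le ?_ |>.imp fun _ h => h.symm
    have : ((⌊2 ^ n * v⌋ : ℤ) : ℝ) ≤ ((numeral y + D : ℤ) : ℝ) := by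
      push_cast
      linarith [hrem.1, hrem.2]
    have := Int.cast_le.mp this
    omega
  have hdR : (d : ℝ) = numeral y + D - ⌊2 ^ n * v⌋ := by exact_mod_cast hd
  have hd2 : d ≤ 2 * D := by
    have : (d : ℝ) ≤ 2 * D := by linarith [hrem.1, hrem.2]
    exact_mod_cast this
  have hdec : binaryDecoder D ((Nat.pair n (Nat.pair m d), []), w, B) = y := by
    refine binaryDecoder_eq (baseNumerator_ne_zero _ _) (length_initWord _ _) (fun u => ?_)
      fun u hu hle => le_of_numeral_le (length_initWord _ _) hu hle
    constructor
    · intro h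
      have : (numeral u : ℝ) < numeral y + 1 := by linarith
      exact Nat.lt_succ_iff.mp (by exact_mod_cast this)
    · intro h
      have : (numeral u : ℝ) ≤ numeral y := by exact_mod_cast h
      linarith
  have := hc o (Nat.pair n (Nat.pair m d)) [] w rfl
  simp only [Nat.unpair_pair, ← hB, hdec, List.length_nil] at this
  have hs := size_pair_pair_le n m d
  have hs2 : (n + m + d + 1).size ≤ (n + m + max c (2 * D) + 1).size :=
    Nat.size_le_size (by omega)
  change complexity U y o ≤ complexity U w o + _ + _
  omega

/-- The number of bits by which the precision `2 ^ (-n)` has to be refined in order to separate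
the values of words of length `m`. -/
noncomputable def extraBits (β : ℝ) (halg : IsAlgebraic ℤ β) (m : ℕ) : ℕ :=
  4 + (galoisConjugates β halg).card * m.size +
    ⌈(m : ℝ) * Real.logb 2 ((intMinpoly β halg).leadingCoeff * outerConjugateProd β halg)⌉₊

theorem lt_two_pow_extraBits (β : ℝ) (halg : IsAlgebraic ℤ β) (m : ℕ) :
    8 * (m : ℝ) ^ (galoisConjugates β halg).card *
      ((intMinpoly β halg).leadingCoeff * outerConjugateProd β halg) ^ m <
        2 ^ extraBits β halg m := by
  have hR1 := one_le_lead_mul_outerConjugateProd β halg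
  set R : ℝ := (intMinpoly β halg).leadingCoeff * outerConjugateProd β halg
  have hR : R ^ m ≤ 2 ^ ⌈(m : ℝ) * Real.logb 2 R⌉₊ := by
    have h : R ^ m = (2 : ℝ) ^ ((m : ℝ) * Real.logb 2 R) := by
      rw [mul_comm, Real.rpow_mul two_pos.le, Real.rpow_logb two_pos (by norm_num) (by linarith),
        Real.rpow_natCast]
    rw [h, ← Real.rpow_natCast]
    exact Real.rpow_le_rpow_of_exponent_le one_le_two (Nat.le_ceil _)
  have hm : (m : ℝ) ≤ 2 ^ m.size := by exact_mod_cast (Nat.lt_size_self m).le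
  rw [extraBits, pow_add, pow_add, mul_comm _ m.size, pow_mul]
  have hp : (0 : ℝ) < (2 ^ m.size) ^ (galoisConjugates β halg).card *
    2 ^ ⌈(m : ℝ) * Real.logb 2 R⌉₊ := by positivity
  calc 8 * (m : ℝ) ^ (galoisConjugates β halg).card * R ^ m
      ≤ 8 * (2 ^ m.size) ^ (galoisConjugates β halg).card *
        2 ^ ⌈(m : ℝ) * Real.logb 2 R⌉₊ := by gcongr
    _ < _ := by norm_num; linarith

/-- The representative of length `n(β)` can be computed from the prefix of length `n` of the
binary expansion of `s`, the extra bits that separate its value from that of every other word, and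
`O(log n)` further bits. -/
theorem exists_complexity_rep_le (hU : IsUniversal U) (hβ : β ∈ Set.Ioo (1 : ℝ) 2)
    (halg : IsAlgebraic ℤ β) {x : ℕ → Bool} (hx : x ∈ Omega β) :
    ∃ c : ℕ, ∀ n : ℕ, complexityBase U β (lexMaxSeq β x (scaledLength β n)) ≤
      complexityBase U β (initWord (greedyBinary (seqValue β x)) n) +
        extraBits β halg (scaledLength β n) +
        8 * (n + scaledLength β n + extraBits β halg (scaledLength β n) + 1).size + c := by
  -- `D` exceeds the truncation errors, so that the offset below is a natural number
  set D : ℕ := ⌈(β - 1)⁻¹⌉₊ + 2 with hDdef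
  have hD : (β - 1)⁻¹ + 2 ≤ D := by
    rw [hDdef]; push_cast; linarith [Nat.le_ceil (β - 1)⁻¹]
  have hβ0 : 0 < β := by linarith [hβ.1]
  have hβ1 : 0 < (β - 1)⁻¹ := inv_pos.mpr (by linarith [hβ.1])
  obtain ⟨c, hc⟩ := hU.complexity_decoder_le (ℓ := fun t => t.unpair.2.unpair.2 + (D + 1))
    (Primrec.nat_add.comp (primrec_unpair_snd.comp primrec_unpair_snd) (Primrec.const (D + 1)))
    primrec_repPrecision (primrec_repDecoder D)
  refine ⟨c + (D + 1), fun n => ?_⟩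
  set o := greedyBinary (β - 1) with ho
  set y := initWord (greedyBinary (seqValue β x)) n with hy
  set m := scaledLength β n
  set w := lexMaxSeq β x m
  set b := extraBits β halg m
  have hwl : w.length = m := length_lexMaxSeq β x m
  obtain ⟨hv1, hv2⟩ := wordValue_lexMaxSeq_bounds hβ.1 x n
  have hrem := greedyRem_mem (s := seqValue β x) ⟨seqValue_nonneg hβ.1 x, hx⟩ n
  have hnum := numeral_initWord_greedyBinary (seqValue β x) n
  rw [← hy] at hnum
  have happ : ∀ u : List Bool, u.length = m → _ := fun u hu => by
    have := abs_wordValue_approx_le hβ (w := u) (n + b)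
    rw [hu] at this
    exact abs_le.mp this
  set B := baseNumerator o (precision (n + b) m) with hB
  have hb : (1 : ℝ) ≤ 2 ^ b := one_le_pow₀ one_le_two
  have hvb : (2 : ℝ) ^ (n + b) * wordValue β w = 2 ^ b * (2 ^ n * wordValue β w) := by ring
  have hlow : (2 : ℝ) ^ b * (numeral y - (β - 1)⁻¹) ≤ 2 ^ (n + b) * wordValue β w := by
    rw [hvb]
    gcongr
    linarith [hrem.1]
  have hupp : (2 : ℝ) ^ (n + b) * wordValue β w ≤ 2 ^ b * (numeral y + 1) := by
    rw [hvb]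
    gcongr
    linarith [hrem.2]
  set T : ℤ := ⌊(2 : ℝ) ^ (n + b) * wordValue β w⌋ with hT
  have hf1 := Int.floor_le ((2 : ℝ) ^ (n + b) * wordValue β w)
  have hf2 := Int.lt_floor_add_one ((2 : ℝ) ^ (n + b) * wordValue β w)
  rw [← hT] at hf1 hf2
  -- the word `J` with numeral `j` locates the value of `w` at precision `2 ^ (-(n + b))`
  obtain ⟨j, hj⟩ : ∃ j : ℕ, (j : ℤ) = T - 2 ^ b * numeral y + 2 ^ b * D := by
    refine Int.eq_ofNat_of_zero_le ?_ |>.imp fun _ h => h.symm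
    have : (0 : ℝ) ≤ ((T - 2 ^ b * numeral y + 2 ^ b * D : ℤ) : ℝ) := by
      push_cast
      nlinarith
    exact_mod_cast this
  have hjR : (j : ℝ) = T - 2 ^ b * numeral y + 2 ^ b * D := by exact_mod_cast hj
  have hj2 : j < 2 ^ (b + (D + 1)) := by
    have h1 : (j : ℝ) ≤ 2 ^ b * (D + 1) := by nlinarith
    have h2 : j ≤ 2 ^ b * (D + 1) := by exact_mod_cast h1
    rw [pow_add]
    exact h2.trans_lt (Nat.mul_lt_mul_of_pos_left Nat.lt_two_pow_self (Nat.two_pow_pos b))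
  obtain ⟨J, hJl, hJ⟩ := exists_numeral_eq hj2
  have hTJ : (2 : ℝ) ^ b * numeral y + numeral J - 2 ^ b * D = T := by rw [hJ, hjR]; ring
  have hdec : repDecoder D ((Nat.pair n (Nat.pair m b), J), y, B) = w := by
    refine repDecoder_eq (baseNumerator_ne_zero _ _) hwl ?_ fun u hu hle => ?_
    · rw [hTJ, abs_le]
      obtain ⟨h1, h2⟩ := happ w hwl
      constructor <;> linarith
    · -- a word in the window has the same value as `w`, so it lies in the class of `w`
      suffices h : wordValue β u = wordValue β w from
        le_lexMaxRep ⟨hu.trans (length_initWord x m).symm, h.trans (lexMaxRep_mem _ _).2⟩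
      by_contra hne
      rw [hTJ, abs_le] at hle
      obtain ⟨h1, h2⟩ := happ u hu
      have hdiff : (2 : ℝ) ^ (n + b) * |wordValue β u - wordValue β w| ≤ 4 := by
        have h0 : (2 : ℝ) ^ (n + b) * |wordValue β u - wordValue β w| =
            |2 ^ (n + b) * wordValue β u - 2 ^ (n + b) * wordValue β w| := by
          rw [← mul_sub, abs_mul, abs_of_pos (by positivity : (0 : ℝ) < 2 ^ (n + b))]
        rw [h0, abs_le]
        constructor <;> linarith
      have hsep := wordValue_separation hβ.1 halg hu hwl hne
      have hbits := lt_two_pow_extraBits β halg m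
      have hm := pow_scaledLength_le hβ.1 n
      have hR1 := one_le_lead_mul_outerConjugateProd β halg
      set R : ℝ := (intMinpoly β halg).leadingCoeff * outerConjugateProd β halg
      set g := (galoisConjugates β halg).card
      set δ := |wordValue β u - wordValue β w|
      have hδ : 0 < δ := abs_pos.mpr (sub_ne_zero.mpr hne)
      have hm2 : β ^ m ≤ 2 * 2 ^ n := hm.trans (by gcongr; exact hβ.2.le)
      have h3 : (2 : ℝ) ^ b ≤ 8 * m ^ g * R ^ m := by
        calc (2 : ℝ) ^ b ≤ 2 ^ b * (β ^ m * δ * m ^ g * R ^ m) :=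
              le_mul_of_one_le_right (by positivity) hsep
          _ ≤ 2 ^ b * (2 * 2 ^ n * δ * m ^ g * R ^ m) := by gcongr
          _ = 2 * (2 ^ (n + b) * δ) * m ^ g * R ^ m := by ring
          _ ≤ 2 * 4 * m ^ g * R ^ m := by gcongr
          _ = _ := by ring
      exact absurd hbits (not_lt.mpr h3)
  have := hc o (Nat.pair n (Nat.pair m b)) J y (by simpa using hJl)
  simp only [repPrecision, Nat.unpair_pair, ← hB, hdec, hJl] at this
  have hs := size_pair_pair_le n m b
  change complexity U w o ≤ complexity U y o + _ + _ + _
  omega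

end Estimates

/-! ### Asymptotics -/

open Filter Topology

theorem size_sq_le (a : ℕ) : a.size ^ 2 ≤ 4 * (a + 1) := by
  have key : ∀ s : ℕ, (s + 1) ^ 2 ≤ 4 * 2 ^ s := by
    intro s
    induction s with
    | zero => norm_num
    | succ s ih =>
      rcases s with _ | _ | s
      · norm_num
      · norm_num
      · rw [pow_succ 2]; nlinarith [Nat.zero_le (s * s)]
  rcases hs : a.size with _ | s
  · simp
  · have : 2 ^ s ≤ a := Nat.lt_size.mp (by omega)
    have := key s
    omega

theorem tendsto_size_div {a : ℕ → ℕ} {l : ℝ}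
    (ha : Tendsto (fun n : ℕ => (a n : ℝ) / n) atTop (𝓝 l)) :
    Tendsto (fun n : ℕ => ((a n).size : ℝ) / n) atTop (𝓝 0) := by
  have hinv := tendsto_one_div_atTop_nhds_zero_nat (𝕜 := ℝ)
  have h1 : Tendsto (fun n : ℕ => √(4 * (((a n : ℝ) / n + 1 / n) * (1 / n)))) atTop (𝓝 0) := by
    have := ((((ha.add hinv).mul hinv).const_mul 4)).sqrt
    simpa using this
  refine squeeze_zero (fun n => by positivity) (fun n => ?_) h1
  refine Real.le_sqrt_of_sq_le ?_
  have h : ((a n).size : ℝ) ^ 2 ≤ 4 * (a n + 1) := by exact_mod_cast size_sq_le (a n)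
  calc (((a n).size : ℝ) / n) ^ 2 = ((a n).size : ℝ) ^ 2 * (1 / (n : ℝ)) ^ 2 := by ring
    _ ≤ 4 * ((a n : ℝ) + 1) * (1 / (n : ℝ)) ^ 2 := by gcongr
    _ = 4 * (((a n : ℝ) / n + 1 / n) * (1 / n)) := by ring

theorem tendsto_const_div (c : ℝ) : Tendsto (fun n : ℕ => c / (n : ℝ)) atTop (𝓝 0) :=
  tendsto_const_nhds.div_atTop tendsto_natCast_atTop_atTop

theorem tendsto_natCast_div_self : Tendsto (fun n : ℕ => (n : ℝ) / n) atTop (𝓝 1) := by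
  refine tendsto_const_nhds.congr' ?_
  filter_upwards [eventually_ne_atTop 0] with n hn
  rw [div_self (by exact_mod_cast hn)]

theorem tendsto_ceil_mul_div {a : ℕ → ℕ} {l r : ℝ} (hr : 0 ≤ r)
    (ha : Tendsto (fun n : ℕ => (a n : ℝ) / n) atTop (𝓝 l)) :
    Tendsto (fun n : ℕ => (⌈(a n : ℝ) * r⌉₊ : ℝ) / n) atTop (𝓝 (l * r)) := by
  have h1 : Tendsto (fun n : ℕ => (a n : ℝ) / n * r) atTop (𝓝 (l * r)) := ha.mul_const r
  have h2 : Tendsto (fun n : ℕ => (a n : ℝ) / n * r + 1 / n) atTop (𝓝 (l * r)) := by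
    simpa using h1.add (tendsto_const_div 1)
  refine tendsto_of_tendsto_of_tendsto_of_le_of_le h1 h2 (fun n => ?_) fun n => ?_
  · rw [div_mul_eq_mul_div]
    dsimp only
    gcongr
    exact Nat.le_ceil _
  · dsimp only
    rw [div_mul_eq_mul_div, ← add_div]
    gcongr
    exact (Nat.ceil_lt_add_one (by positivity)).le

theorem tendsto_scaledLength_div {β : ℝ} (hβ : 1 < β) :
    Tendsto (fun n : ℕ => (scaledLength β n : ℝ) / n) atTop (𝓝 (Real.logb β 2)) := by
  simpa [scaledLength] using
    tendsto_ceil_mul_div (Real.logb_pos hβ one_lt_two).le tendsto_natCast_div_self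

theorem tendsto_extraBits_div {β : ℝ} (hβ : 1 < β) (halg : IsAlgebraic ℤ β) :
    Tendsto (fun n : ℕ => (extraBits β halg (scaledLength β n) : ℝ) / n) atTop
      (𝓝 (Real.logb β ((intMinpoly β halg).leadingCoeff * outerConjugateProd β halg))) := by
  have hm := tendsto_scaledLength_div hβ
  have hR := one_le_lead_mul_outerConjugateProd β halg
  have h1 := tendsto_ceil_mul_div (Real.logb_nonneg one_lt_two hR) hm
  have h2 := ((tendsto_size_div hm).const_mul ((galoisConjugates β halg).card : ℝ))
  have hl : Real.logb β 2 *
      Real.logb 2 ((intMinpoly β halg).leadingCoeff * outerConjugateProd β halg) =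
      Real.logb β ((intMinpoly β halg).leadingCoeff * outerConjugateProd β halg) :=
    Real.mul_logb two_ne_zero (by norm_num) (by norm_num)
  have h3 := ((tendsto_const_div 4).add h2).add h1
  rw [hl, mul_zero, zero_add, zero_add] at h3
  refine h3.congr fun n => ?_
  simp only [extraBits]
  push_cast
  ring

end BetaExp

theorem mainTheorem1 (U : (ℕ → Bool) → List Bool →. List Bool) (hU : BetaExp.IsUniversal U)
    (β : ℝ) (hβ : β ∈ Set.Ioo (1 : ℝ) 2) (halg : IsAlgebraic ℤ β)
    (x : ℕ → Bool) (hx : x ∈ BetaExp.Omega β) :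
    0 ≤ BetaExp.lowerDelta U β (BetaExp.seqValue β x) (BetaExp.lexMaxSeq β x) ∧
    BetaExp.lowerDelta U β (BetaExp.seqValue β x) (BetaExp.lexMaxSeq β x) ≤
      BetaExp.upperDelta U β (BetaExp.seqValue β x) (BetaExp.lexMaxSeq β x) ∧
    BetaExp.upperDelta U β (BetaExp.seqValue β x) (BetaExp.lexMaxSeq β x) ≤
      ((Real.logb β (((BetaExp.intMinpoly β halg).leadingCoeff : ℝ) *
        BetaExp.outerConjugateProd β halg) : ℝ) : EReal) := by
  open BetaExp Filter Topology in
  have hm := tendsto_scaledLength_div hβ.1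
  have hb := tendsto_extraBits_div hβ.1 halg
  refine ⟨?_, liminf_le_limsup, ?_⟩
  · obtain ⟨c, hc⟩ := exists_complexity_binary_le hU hβ hx
    have hN : Tendsto (fun n : ℕ => ((n + scaledLength β n + c + 1 : ℕ) : ℝ) / n) atTop
        (𝓝 (1 + Real.logb β 2 + 0)) := by
      refine ((tendsto_natCast_div_self.add hm).add (tendsto_const_div (c + 1))).congr fun n => ?_
      push_cast
      ring
    have hlim : Tendsto (fun n : ℕ => ((-(8 * (((n + scaledLength β n + c + 1).size : ℝ) / n) +
        c / n) : ℝ) : EReal)) atTop (𝓝 0) := by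
      have := (((tendsto_size_div hN).const_mul 8).add (tendsto_const_div c)).neg
      simp only [mul_zero, add_zero, neg_zero] at this
      exact (continuous_coe_real_ereal.tendsto 0).comp this
    rw [← hlim.liminf_eq]
    refine liminf_le_liminf (Eventually.of_forall fun n => EReal.coe_le_coe_iff.mpr ?_)
    have h : (complexityBase U β (initWord (greedyBinary (seqValue β x)) n) : ℝ) ≤
        complexityBase U β (lexMaxSeq β x (scaledLength β n)) +
          8 * (n + scaledLength β n + c + 1).size + c := by exact_mod_cast hc n
    rw [complexityGap, ← mul_div_assoc, ← add_div, ← neg_div]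
    gcongr
    linarith
  · obtain ⟨c, hc⟩ := exists_complexity_rep_le hU hβ halg hx
    have hN : Tendsto (fun n : ℕ => ((n + scaledLength β n +
        extraBits β halg (scaledLength β n) + 1 : ℕ) : ℝ) / n) atTop (𝓝 (1 + Real.logb β 2 +
          Real.logb β ((intMinpoly β halg).leadingCoeff * outerConjugateProd β halg) + 0)) := by
      refine (((tendsto_natCast_div_self.add hm).add hb).add (tendsto_const_div 1)).congr
        fun n => ?_
      push_cast
      ring
    have hlim : Tendsto (fun n : ℕ => (((extraBits β halg (scaledLength β n) : ℝ) / n +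
        8 * (((n + scaledLength β n + extraBits β halg (scaledLength β n) + 1).size : ℝ) / n) +
        c / n : ℝ) : EReal)) atTop
        (𝓝 (Real.logb β ((intMinpoly β halg).leadingCoeff * outerConjugateProd β halg) : ℝ)) := by
      have := (hb.add ((tendsto_size_div hN).const_mul 8)).add (tendsto_const_div c)
      simp only [mul_zero, add_zero] at this
      exact (continuous_coe_real_ereal.tendsto _).comp this
    rw [← hlim.limsup_eq]
    refine limsup_le_limsup (Eventually.of_forall fun n => EReal.coe_le_coe_iff.mpr ?_)
    have h : (complexityBase U β (lexMaxSeq β x (scaledLength β n)) : ℝ) ≤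
        complexityBase U β (initWord (greedyBinary (seqValue β x)) n) +
          extraBits β halg (scaledLength β n) +
          8 * (n + scaledLength β n + extraBits β halg (scaledLength β n) + 1).size + c := by
      exact_mod_cast hc n
    rw [complexityGap, ← mul_div_assoc, ← add_div, ← add_div]
    gcongr
    linarith
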